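/- Let $U\subset\mathbb R^2$ be open and let $P,Q,R,S$ be smooth real functions of $(x,y)\in U$, the coefficients of the equation $$y''=P+3Q\,y'+3R\,(y')^2+S\,(y')^3 .$$ Write $f_{p.q}=\partial_x^p\partial_y^q f$ and put $$A=P_{0.2}-2Q_{1.1}+R_{2.0}+2PS_{1.0}+SP_{1.0}-3PR_{0.1}-3RP_{0.1}-3QR_{1.0}+6QQ_{0.1},$$ $$B=S_{2.0}-2R_{1.1}+Q_{0.2}-2SP_{0.1}-PS_{0.1}+3SQ_{1.0}+3QS_{1.0}+3RQ_{0.1}-6RR_{1.0},$$ $$G=-BB_{1.0}-3AB_{0.1}+4BA_{0.1}+3SA^2-6RBA+3QB^2,$$ $$H=-AA_{0.1}-3BA_{1.0}+4AB_{1.0}-3PB^2+6QAB-3RA^2,\qquad 3F^5=AG+BH .$$ Assume that the equation is of intermediate degeneration on $U$: $F=0$ on $U$, and $\boldsymbol\alpha=(A,B)\neq(0,0)$ at every point of $U$. Bagderina's quantities are $$\alpha_0=Q_{1.0}-P_{0.1}+2PR-2Q^2,\quad \alpha_1=R_{1.0}-Q_{0.1}+PS-QR,\quad \alpha_2=S_{1.0}-R_{0.1}+2QS-2R^2,$$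 $$\beta_1=\partial_x\alpha_1-\partial_y\alpha_0+R\alpha_0-2Q\alpha_1+P\alpha_2,\quad \beta_2=\partial_x\alpha_2-\partial_y\alpha_1+S\alpha_0-2R\alpha_1+Q\alpha_2,$$ $$\gamma_{10}=\partial_x\beta_1-Q\beta_1+P\beta_2,\quad \gamma_{11}=\partial_x\beta_2-R\beta_1+Q\beta_2,\quad \gamma_{20}=\partial_y\beta_1-R\beta_1+Q\beta_2,\quad \gamma_{21}=\partial_y\beta_2-S\beta_1+R\beta_2,$$ $$\delta_{10}=\partial_x\gamma_{10}-2Q\gamma_{10}+P(\gamma_{20}+\gamma_{11})-5\alpha_0\beta_1,\quad \delta_{20}=\partial_x\gamma_{20}-R\gamma_{10}+P\gamma_{21}-4\alpha_1\beta_1-\alpha_0\beta_2,$$ $$\delta_{30}=\partial_y\gamma_{20}-S\gamma_{10}+Q\gamma_{21}-4\alpha_2\beta_1-\alpha_1\beta_2,\quad \delta_{11}=\partial_x\gamma_{11}-R\gamma_{10}+P\gamma_{21}-\alpha_1\beta_1-4\alpha_0\beta_2,$$ and, where $\beta_1\neq0$, $$j_0=\frac{3}{\beta_1}\Bigl(\frac{\beta_2}{\beta_1}\delta_{10}-\delta_{11}\Bigr)+\frac{6\gamma_{10}}{\beta_1^2}\Bigl(\gamma_{11}-\frac{\beta_2}{\beta_1}\gamma_{10}\Bigr),$$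 $$j_1=\frac56\Bigl(2\beta_2\delta_{20}-\beta_1\delta_{30}-\frac{\beta_2^2}{\beta_1}\delta_{10}\Bigr)+\Bigl(\gamma_{20}-\frac23\gamma_{11}-\frac{\beta_2}{3\beta_1}\gamma_{10}\Bigr)\Bigl(\gamma_{20}+\gamma_{11}-2\frac{\beta_2}{\beta_1}\gamma_{10}\Bigr),$$ $$j_2=\frac1{\beta_1}\Bigl(\delta_{20}-\frac{\beta_2}{\beta_1}\delta_{10}\Bigr)+\frac{\gamma_{10}}{5\beta_1^2}\Bigl(7\frac{\beta_2}{\beta_1}\gamma_{10}-6\gamma_{20}-\gamma_{11}\Bigr),\qquad j_3=\frac35\Bigl(\frac{\delta_{10}}{\beta_1^3}-\frac{6\gamma_{10}^2}{5\beta_1^4}\Bigr),$$ $$j_5=5\bigl(2j_1j_3+(j_2-j_0/6)^2\bigr).$$ Then the following hold. (1) $j_5$ transforms as a pseudoscalar field of weight $2$. That is, let $(x,y)\mapsto(\tilde x(x,y),\tilde y(x,y))$ be a smooth map from $U$ to an open set $V$ whose Jacobi matrix $T=\begin{pmatrix}\tilde x_{1.0}&\tilde x_{0.1}\\ \tilde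 y_{1.0}&\tilde y_{0.1}\end{pmatrix}$ is invertible on $U$, and suppose that this change of variables turns the given equation into the equation $\tilde y''=\tilde P+3\tilde Q\tilde y'+3\tilde R(\tilde y')^2+\tilde S(\tilde y')^3$ with smooth coefficients on $V$. If $\tilde\jmath_5,\tilde\beta_1$ denote the same expressions formed from $\tilde P,\tilde Q,\tilde R,\tilde S$, then $$j_5=(\det T)^2\,\tilde\jmath_5$$ at every point of $U$ at which $\beta_1\neq0$ and at whose image $\tilde\beta_1\neq0$. (2) At every point of $U$ with $\beta_1\neq0$, $$j_5=-125\,\det(\mathbf R)+\tfrac{45}{4}\,\Omega^2 .$$ Here $x^1=x$, $x^2=y$, and $\varphi_1,\varphi_2$ are given by $$\varphi_1=-3\frac{BP+A_{1.0}}{5A}+\frac35Q,\qquad \varphi_2=3B\frac{BP+A_{1.0}}{5A^2}-3\frac{B_{1.0}+A_{0.1}+3BQ}{5A}+\frac65R$$ where $A\neq0$, and where $A=0$ (hence $B\neq0$) by $$\varphi_1=-3A\frac{AS-B_{0.1}}{5B^2}-3\frac{A_{0.1}+B_{1.0}-3AR}{5B}-\frac65Q,\qquad \varphi_2=3\frac{AS-B_{0.1}}{5B}-\frac35R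 .$$ Further, $(d^{ij})=\begin{pmatrix}0&1\\-1&0\end{pmatrix}$; $\theta_{ijk}$ is the symmetric array with $\theta_{111}=P$, $\theta_{112}=Q$, $\theta_{122}=R$, $\theta_{222}=S$; $\theta^k_{ij}=\sum_r d^{kr}\theta_{rij}$; $\Gamma^k_{ij}=\theta^k_{ij}-\frac13(\varphi_i\delta^k_j+\varphi_j\delta^k_i)$; $$R^k_{rij}=\frac{\partial\Gamma^k_{jr}}{\partial x^i}-\frac{\partial\Gamma^k_{ir}}{\partial x^j}+\sum_q\Gamma^k_{iq}\Gamma^q_{jr}-\sum_q\Gamma^k_{jq}\Gamma^q_{ir};$$ $\mathbf R=(R^k_q)$ with $R^k_q=\frac12\sum_{i,j}R^k_{qij}d^{ij}$; and $\Omega=\frac56\sum_{i,j}\bigl(\frac{\partial\varphi_i}{\partial x^j}-\frac{\partial\varphi_j}{\partial x^i}\bigr)d^{ij}$. -/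

import Mathlib

open scoped ContDiff

noncomputable section

/-- The `i`-th partial derivative of a function on the coordinate plane, where
`x¹ = x` (index `0`) and `x² = y` (index `1`). -/
def pd (i : Fin 2) (f : ℝ × ℝ → ℝ) (p : ℝ × ℝ) : ℝ :=
  fderiv ℝ f p (![((1 : ℝ), (0 : ℝ)), ((0 : ℝ), (1 : ℝ))] i)

/-- The partial derivative in `x`. -/
abbrev dx (f : ℝ × ℝ → ℝ) : ℝ × ℝ → ℝ := pd 0 f

/-- The partial derivative in `y`. -/
abbrev dy (f : ℝ × ℝ → ℝ) : ℝ × ℝ → ℝ := pd 1 f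

/-- The coefficients of an equation `y'' = P + 3 Q y' + 3 R (y')² + S (y')³`
written in local coordinates `(x, y)`. -/
structure CubicODE where
  P : ℝ × ℝ → ℝ
  Q : ℝ × ℝ → ℝ
  R : ℝ × ℝ → ℝ
  S : ℝ × ℝ → ℝ

namespace CubicODE

variable (E : CubicODE)

/-- The coefficients are smooth on `U`. -/
def SmoothOn (U : Set (ℝ × ℝ)) : Prop :=
  ContDiffOn ℝ ∞ E.P U ∧ ContDiffOn ℝ ∞ E.Q U ∧ ContDiffOn ℝ ∞ E.R U ∧ ContDiffOn ℝ ∞ E.S U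

/-- The right-hand side of the equation at the point `p = (x, y)` with slope `y' = s`. -/
def rhs (p : ℝ × ℝ) (s : ℝ) : ℝ :=
  E.P p + 3 * E.Q p * s + 3 * E.R p * s ^ 2 + E.S p * s ^ 3

/-! The pseudocovectorial field `α = (A, B)`, the quantities `G`, `H` and the field `F`. -/

def A (p : ℝ × ℝ) : ℝ :=
  dy (dy E.P) p - 2 * dx (dy E.Q) p + dx (dx E.R) p
    + 2 * E.P p * dx E.S p + E.S p * dx E.P p
    - 3 * E.P p * dy E.R p - 3 * E.R p * dy E.P p
    - 3 * E.Q p * dx E.R p + 6 * E.Q p * dy E.Q p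

def B (p : ℝ × ℝ) : ℝ :=
  dx (dx E.S) p - 2 * dx (dy E.R) p + dy (dy E.Q) p
    - 2 * E.S p * dy E.P p - E.P p * dy E.S p
    + 3 * E.S p * dx E.Q p + 3 * E.Q p * dx E.S p
    + 3 * E.R p * dy E.Q p - 6 * E.R p * dx E.R p

def G (p : ℝ × ℝ) : ℝ :=
  -E.B p * dx E.B p - 3 * E.A p * dy E.B p + 4 * E.B p * dy E.A p
    + 3 * E.S p * E.A p ^ 2 - 6 * E.R p * E.B p * E.A p + 3 * E.Q p * E.B p ^ 2

def H (p : ℝ × ℝ) : ℝ :=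
  -E.A p * dy E.A p - 3 * E.B p * dx E.A p + 4 * E.A p * dx E.B p
    - 3 * E.P p * E.B p ^ 2 + 6 * E.Q p * E.A p * E.B p - 3 * E.R p * E.A p ^ 2

/-- The fifth power of the field `F`, defined by `3 F⁵ = A G + B H`. -/
def F5 (p : ℝ × ℝ) : ℝ := (E.A p * E.G p + E.B p * E.H p) / 3

/-- The field `F`: the real fifth root of `(A G + B H) / 3`. -/
def F (p : ℝ × ℝ) : ℝ := SignType.sign (E.F5 p) * |E.F5 p| ^ ((1 : ℝ) / 5)

theorem F_pow_five (p : ℝ × ℝ) : E.F p ^ 5 = E.F5 p := by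
  have key : (|E.F5 p| ^ ((1 : ℝ) / 5)) ^ 5 = |E.F5 p| := by
    rw [← Real.rpow_natCast, ← Real.rpow_mul (abs_nonneg _)]
    norm_num
  unfold F
  rw [mul_pow, key]
  rcases lt_trichotomy (E.F5 p) 0 with h | h | h
  · rw [sign_neg h, abs_of_neg h]; norm_num
  · rw [h]; simp
  · rw [sign_pos h, abs_of_pos h]; norm_num

/-- The cases of intermediate degeneration: `F = 0` identically and `α = (A, B)` does not
vanish at any point of the domain. -/
def IntermediateDegeneration (U : Set (ℝ × ℝ)) : Prop :=
  ∀ p ∈ U, E.F p = 0 ∧ (E.A p ≠ 0 ∨ E.B p ≠ 0)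

/-! Bagderina's quantities. -/

def alpha0 (p : ℝ × ℝ) : ℝ := dx E.Q p - dy E.P p + 2 * E.P p * E.R p - 2 * E.Q p ^ 2

def alpha1 (p : ℝ × ℝ) : ℝ := dx E.R p - dy E.Q p + E.P p * E.S p - E.Q p * E.R p

def alpha2 (p : ℝ × ℝ) : ℝ := dx E.S p - dy E.R p + 2 * E.Q p * E.S p - 2 * E.R p ^ 2

def beta1 (p : ℝ × ℝ) : ℝ :=
  dx E.alpha1 p - dy E.alpha0 p + E.R p * E.alpha0 p - 2 * E.Q p * E.alpha1 p
    + E.P p * E.alpha2 p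

def beta2 (p : ℝ × ℝ) : ℝ :=
  dx E.alpha2 p - dy E.alpha1 p + E.S p * E.alpha0 p - 2 * E.R p * E.alpha1 p
    + E.Q p * E.alpha2 p

def gamma10 (p : ℝ × ℝ) : ℝ := dx E.beta1 p - E.Q p * E.beta1 p + E.P p * E.beta2 p

def gamma11 (p : ℝ × ℝ) : ℝ := dx E.beta2 p - E.R p * E.beta1 p + E.Q p * E.beta2 p

def gamma20 (p : ℝ × ℝ) : ℝ := dy E.beta1 p - E.R p * E.beta1 p + E.Q p * E.beta2 p

def gamma21 (p : ℝ × ℝ) : ℝ := dy E.beta2 p - E.S p * E.beta1 p + E.R p * E.beta2 p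

def delta10 (p : ℝ × ℝ) : ℝ :=
  dx E.gamma10 p - 2 * E.Q p * E.gamma10 p + E.P p * (E.gamma20 p + E.gamma11 p)
    - 5 * E.alpha0 p * E.beta1 p

def delta20 (p : ℝ × ℝ) : ℝ :=
  dx E.gamma20 p - E.R p * E.gamma10 p + E.P p * E.gamma21 p
    - 4 * E.alpha1 p * E.beta1 p - E.alpha0 p * E.beta2 p

def delta30 (p : ℝ × ℝ) : ℝ :=
  dy E.gamma20 p - E.S p * E.gamma10 p + E.Q p * E.gamma21 p
    - 4 * E.alpha2 p * E.beta1 p - E.alpha1 p * E.beta2 p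

def delta11 (p : ℝ × ℝ) : ℝ :=
  dx E.gamma11 p - E.R p * E.gamma10 p + E.P p * E.gamma21 p
    - E.alpha1 p * E.beta1 p - 4 * E.alpha0 p * E.beta2 p

/-! The quantities `j₀, j₁, j₂, j₃, j₅`; they are meaningful where `β₁ ≠ 0`. -/

def j0 (p : ℝ × ℝ) : ℝ :=
  3 / E.beta1 p * (E.beta2 p / E.beta1 p * E.delta10 p - E.delta11 p)
    + 6 * E.gamma10 p / E.beta1 p ^ 2
      * (E.gamma11 p - E.beta2 p / E.beta1 p * E.gamma10 p)

def j1 (p : ℝ × ℝ) : ℝ :=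
  5 / 6 * (2 * E.beta2 p * E.delta20 p - E.beta1 p * E.delta30 p
      - E.beta2 p ^ 2 / E.beta1 p * E.delta10 p)
    + (E.gamma20 p - 2 / 3 * E.gamma11 p - E.beta2 p / (3 * E.beta1 p) * E.gamma10 p)
      * (E.gamma20 p + E.gamma11 p - 2 * (E.beta2 p / E.beta1 p) * E.gamma10 p)

def j2 (p : ℝ × ℝ) : ℝ :=
  1 / E.beta1 p * (E.delta20 p - E.beta2 p / E.beta1 p * E.delta10 p)
    + E.gamma10 p / (5 * E.beta1 p ^ 2)
      * (7 * (E.beta2 p / E.beta1 p) * E.gamma10 p - 6 * E.gamma20 p - E.gamma11 p)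

def j3 (p : ℝ × ℝ) : ℝ :=
  3 / 5 * (E.delta10 p / E.beta1 p ^ 3 - 6 * E.gamma10 p ^ 2 / (5 * E.beta1 p ^ 4))

def j5 (p : ℝ × ℝ) : ℝ :=
  5 * (2 * E.j1 p * E.j3 p + (E.j2 p - E.j0 p / 6) ^ 2)

/-! The connection attached to an equation of intermediate degeneration, and its curvature. -/

/-- The quantities `φ₁` (index `0`) and `φ₂` (index `1`). There is one formula for `A ≠ 0` and
one for `B ≠ 0`; in the cases of intermediate degeneration they agree where both apply. -/
def phi (i : Fin 2) (p : ℝ × ℝ) : ℝ :=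
  if E.A p ≠ 0 then
    ![-3 * ((E.B p * E.P p + dx E.A p) / (5 * E.A p)) + 3 / 5 * E.Q p,
      3 * E.B p * ((E.B p * E.P p + dx E.A p) / (5 * E.A p ^ 2))
        - 3 * ((dx E.B p + dy E.A p + 3 * E.B p * E.Q p) / (5 * E.A p)) + 6 / 5 * E.R p] i
  else
    ![-3 * E.A p * ((E.A p * E.S p - dy E.B p) / (5 * E.B p ^ 2))
        - 3 * ((dy E.A p + dx E.B p - 3 * E.A p * E.R p) / (5 * E.B p)) - 6 / 5 * E.Q p,
      3 * ((E.A p * E.S p - dy E.B p) / (5 * E.B p)) - 3 / 5 * E.R p] i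

/-- The constant skew-symmetric matrix `d`. -/
def dMat : Matrix (Fin 2) (Fin 2) ℝ := !![0, 1; -1, 0]

/-- The symmetric array `θ_{ijk}`: `θ₁₁₁ = P`, `θ₁₁₂ = Q`, `θ₁₂₂ = R`, `θ₂₂₂ = S`. -/
def thetaLow (i j k : Fin 2) : ℝ × ℝ → ℝ :=
  ![E.P, E.Q, E.R, E.S] ⟨i.val + j.val + k.val, by omega⟩

/-- `θ^k_{ij} = ∑ᵣ d^{kr} θ_{rij}`, the Thomas array of the equation. -/
def theta (k i j : Fin 2) (p : ℝ × ℝ) : ℝ := ∑ r, dMat k r * E.thetaLow r i j p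

/-- The connection components `Γ^k_{ij} = θ^k_{ij} - (φᵢ δ^k_j + φⱼ δ^k_i) / 3`. -/
def conn (k i j : Fin 2) (p : ℝ × ℝ) : ℝ :=
  E.theta k i j p
    - (E.phi i p * (if k = j then 1 else 0) + E.phi j p * (if k = i then 1 else 0)) / 3

/-- The curvature tensor `R^k_{rij}` of the connection. -/
def riem (k r i j : Fin 2) (p : ℝ × ℝ) : ℝ :=
  pd i (E.conn k j r) p - pd j (E.conn k i r) p
    + ∑ q, E.conn k i q p * E.conn q j r p - ∑ q, E.conn k j q p * E.conn q i r p

/-- The curvature pseudotensor `R^k_q = ½ ∑_{ij} R^k_{qij} d^{ij}` of type `(1,1)`. -/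
def curv (p : ℝ × ℝ) : Matrix (Fin 2) (Fin 2) ℝ :=
  Matrix.of fun k q => 1 / 2 * ∑ i, ∑ j, E.riem k q i j p * dMat i j

/-- The pseudoscalar field `Ω = (5/6) ∑_{ij} (∂φᵢ/∂xʲ - ∂φⱼ/∂xⁱ) d^{ij}`. -/
def Omega (p : ℝ × ℝ) : ℝ :=
  5 / 6 * ∑ i, ∑ j, (pd j (E.phi i) p - pd i (E.phi j) p) * dMat i j

end CubicODE

/-! Point transformations `x̃ = x̃(x, y)`, `ỹ = ỹ(x, y)`, written as `Φ = (x̃, ỹ)`. -/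

/-- The transition matrix `T` of `Φ`, that is the matrix of partial derivatives of `(x̃, ỹ)`. -/
def transitionMatrix (Φ : ℝ × ℝ → ℝ × ℝ) (p : ℝ × ℝ) : Matrix (Fin 2) (Fin 2) ℝ :=
  !![dx (fun z => (Φ z).1) p, dy (fun z => (Φ z).1) p;
     dx (fun z => (Φ z).2) p, dy (fun z => (Φ z).2) p]

/-- `Φ` is a smooth locally invertible point transformation from `U` to `V`. -/
def IsPointTransformation (Φ : ℝ × ℝ → ℝ × ℝ) (U V : Set (ℝ × ℝ)) : Prop :=
  ContDiffOn ℝ ∞ Φ U ∧ Set.MapsTo Φ U V ∧ ∀ p ∈ U, (transitionMatrix Φ p).det ≠ 0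

/-- The first total derivative of `f` along a curve `y = y(x)` through `p` with `y' = s`. -/
def totalDeriv (f : ℝ × ℝ → ℝ) (p : ℝ × ℝ) (s : ℝ) : ℝ := dx f p + dy f p * s

/-- The second total derivative of `f` along a curve `y = y(x)` through `p` with
`y' = s`, `y'' = w`. -/
def totalDeriv2 (f : ℝ × ℝ → ℝ) (p : ℝ × ℝ) (s w : ℝ) : ℝ :=
  dx (dx f) p + 2 * dx (dy f) p * s + dy (dy f) p * s ^ 2 + dy f p * w

/-- The slope `dỹ/dx̃` of the image of a curve with slope `s` at `p`. -/
def newSlope (Φ : ℝ × ℝ → ℝ × ℝ) (p : ℝ × ℝ) (s : ℝ) : ℝ :=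
  totalDeriv (fun z => (Φ z).2) p s / totalDeriv (fun z => (Φ z).1) p s

/-- The second derivative `d²ỹ/dx̃²` of the image of a curve with `y' = s`, `y'' = w` at `p`. -/
def newSecond (Φ : ℝ × ℝ → ℝ × ℝ) (p : ℝ × ℝ) (s w : ℝ) : ℝ :=
  (totalDeriv (fun z => (Φ z).1) p s * totalDeriv2 (fun z => (Φ z).2) p s w
    - totalDeriv (fun z => (Φ z).2) p s * totalDeriv2 (fun z => (Φ z).1) p s w)
    / totalDeriv (fun z => (Φ z).1) p s ^ 3

/-- On `U`, the change of variables `Φ` turns the equation `E` into the equation `E'`: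
a second order jet `(x, y, y', y'')` over `U` satisfies `E` if and only if its image
under the prolongation of `Φ` satisfies `E'`. (Jets that become vertical in the new
coordinates have no image.) -/
def CubicODE.TransformsTo (E : CubicODE) (Φ : ℝ × ℝ → ℝ × ℝ) (U : Set (ℝ × ℝ))
    (E' : CubicODE) : Prop :=
  ∀ p ∈ U, ∀ s w : ℝ, totalDeriv (fun z => (Φ z).1) p s ≠ 0 →
    (w = E.rhs p s ↔ newSecond Φ p s w = E'.rhs (Φ p) (newSlope Φ p s))

end

/-! Everything rests on one torsion-free affine connection. The coefficients `P, Q, R, S` are the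
components of the trace-free Thomas connection; `alpha0, alpha1, alpha2` are its Ricci tensor,
`(beta1, beta2)` is the curl of that tensor, and the gammas are the covariant derivatives of
`(beta1, beta2)`. Moreover `(beta1, beta2) = (A, B)`.

Up to sign, `F5` is the symmetrized derivative of `(β₁, β₂)` evaluated on the kernel vector `(β₂,
-β₁)` (`F5_eq`). So `F = 0` says that this quadratic form is divisible by the linear form `(β₁,
β₂)`, and the quotient is, up to the factor `-5/3`, the pair `(φ₁, φ₂)`. This characterizes `φ`
uniquely (`isCompatible_phi`, `IsCompatible.unique`) without its two explicit formulas.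

Under a point transformation the Thomas connection obeys the affine law corrected by `jacLog`, a
third of the logarithmic derivative of the Jacobian (`PullbackAt`). Equality of mixed derivatives
gives the law of `jacLog` and then that of `(β₁, β₂)`. By uniqueness `φ` changes by the pullback
minus `3 * jacLog` (`phi_law`), which makes `conn` a true connection and the symmetric part of its
Ricci tensor a true tensor. The determinant of that part has weight two (`det_ric`).

Finally `j5` is `-125` times this determinant (`j5_eq`), while `det curv` is the determinant of the
whole Ricci tensor and exceeds it by the square of the skew part, which is a multiple of `Omega`
(`det_curv`). -/

noncomputable section PointTransformations

open Filter Topology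

/-! ### Calculus of partial derivatives in the plane -/

section PartialDerivatives

variable {f g : ℝ × ℝ → ℝ} {p : ℝ × ℝ} {i : Fin 2}

theorem pd_add (hf : ContDiffAt ℝ ∞ f p) (hg : ContDiffAt ℝ ∞ g p) :
    pd i (fun z => f z + g z) p = pd i f p + pd i g p := by
  unfold pd
  rw [fderiv_fun_add (hf.differentiableAt (by simp)) (hg.differentiableAt (by simp))]
  rfl

theorem pd_sub (hf : ContDiffAt ℝ ∞ f p) (hg : ContDiffAt ℝ ∞ g p) :
    pd i (fun z => f z - g z) p = pd i f p - pd i g p := by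
  unfold pd
  rw [fderiv_fun_sub (hf.differentiableAt (by simp)) (hg.differentiableAt (by simp))]
  rfl

theorem pd_neg : pd i (fun z => -f z) p = -pd i f p := by
  unfold pd
  rw [fderiv_fun_neg]
  rfl

theorem pd_mul (hf : ContDiffAt ℝ ∞ f p) (hg : ContDiffAt ℝ ∞ g p) :
    pd i (fun z => f z * g z) p = f p * pd i g p + g p * pd i f p := by
  unfold pd
  rw [fderiv_fun_mul (hf.differentiableAt (by simp)) (hg.differentiableAt (by simp))]
  rfl

theorem pd_const (c : ℝ) : pd i (fun _ => c) p = 0 := by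
  simp [pd]

theorem pd_pow (n : ℕ) (hf : ContDiffAt ℝ ∞ f p) :
    pd i (fun z => f z ^ n) p = n * f p ^ (n - 1) * pd i f p := by
  unfold pd
  rw [fderiv_fun_pow n (hf.differentiableAt (by simp))]
  simp

theorem pd_congr (h : f =ᶠ[𝓝 p] g) : pd i f p = pd i g p := by
  unfold pd
  rw [h.fderiv_eq]

theorem ContDiffAt.pd (hf : ContDiffAt ℝ ∞ f p) : ContDiffAt ℝ ∞ (pd i f) p := by
  have h : ContDiffAt ℝ ∞ (fderiv ℝ f) p := hf.fderiv_right (by simp)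
  exact h.clm_apply contDiffAt_const

theorem pd_comm (hf : ContDiffAt ℝ ∞ f p) : pd 1 (pd 0 f) p = pd 0 (pd 1 f) p := by
  have h : ContDiffAt ℝ ∞ (fderiv ℝ f) p := hf.fderiv_right (by simp)
  have hs : IsSymmSndFDerivAt ℝ f p := hf.isSymmSndFDerivAt (by
    simp only [minSmoothness_of_isRCLikeNormedField]; exact WithTop.coe_le_coe.2 (le_top : (2 : ℕ∞) ≤ ⊤))
  have key : ∀ i j : Fin 2, pd i (pd j f) p = fderiv ℝ (fderiv ℝ f) p
      (![((1 : ℝ), (0 : ℝ)), ((0 : ℝ), (1 : ℝ))] i)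
      (![((1 : ℝ), (0 : ℝ)), ((0 : ℝ), (1 : ℝ))] j) := by
    intro i j
    change fderiv ℝ (fun q => fderiv ℝ f q (![((1 : ℝ), (0 : ℝ)), ((0 : ℝ), (1 : ℝ))] j)) p _ = _
    rw [fderiv_clm_apply (h.differentiableAt (by simp)) (differentiableAt_const _)]
    simp
  rw [key, key]
  exact hs _ _

theorem pd_comp {Φ : ℝ × ℝ → ℝ × ℝ} (hf : ContDiffAt ℝ ∞ f (Φ p)) (hΦ : ContDiffAt ℝ ∞ Φ p) :
    pd i (fun z => f (Φ z)) p =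
      pd i (fun z => (Φ z).1) p * pd 0 f (Φ p) + pd i (fun z => (Φ z).2) p * pd 1 f (Φ p) := by
  have hΦ' := hΦ.differentiableAt (by simp)
  have h1 : ∀ u, fderiv ℝ (fun z => (Φ z).1) p u = (fderiv ℝ Φ p u).1 := fun u => by
    rw [hΦ'.hasFDerivAt.fst.fderiv]; rfl
  have h2 : ∀ u, fderiv ℝ (fun z => (Φ z).2) p u = (fderiv ℝ Φ p u).2 := fun u => by
    rw [hΦ'.hasFDerivAt.snd.fderiv]; rfl
  unfold pd
  rw [h1, h2, show (fun z => f (Φ z)) = f ∘ Φ from rfl,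
    fderiv_comp p (hf.differentiableAt (by simp)) hΦ', ContinuousLinearMap.comp_apply]
  set w := fderiv ℝ Φ p (![((1 : ℝ), (0 : ℝ)), ((0 : ℝ), (1 : ℝ))] i)
  have hw : w = w.1 • ((1 : ℝ), (0 : ℝ)) + w.2 • ((0 : ℝ), (1 : ℝ)) := by
    ext <;> simp
  conv_lhs => rw [hw, map_add, map_smul, map_smul]
  simp

end PartialDerivatives

/-! ### Smoothness of the basic quantities and the identity `(β₁, β₂) = (A, B)` -/

namespace CubicODE

/-- All coefficients are smooth near a point. -/
def SmoothAt (E : CubicODE) (p : ℝ × ℝ) : Prop :=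
  ContDiffAt ℝ ∞ E.P p ∧ ContDiffAt ℝ ∞ E.Q p ∧ ContDiffAt ℝ ∞ E.R p ∧ ContDiffAt ℝ ∞ E.S p

variable {E : CubicODE} {U : Set (ℝ × ℝ)} {p : ℝ × ℝ}

theorem SmoothOn.smoothAt (hE : E.SmoothOn U) (hU : IsOpen U) (hp : p ∈ U) : E.SmoothAt p :=
  have h := hU.mem_nhds hp
  ⟨hE.1.contDiffAt h, hE.2.1.contDiffAt h, hE.2.2.1.contDiffAt h, hE.2.2.2.contDiffAt h⟩

theorem SmoothAt.alpha0 (hE : E.SmoothAt p) : ContDiffAt ℝ ∞ E.alpha0 p := by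
  obtain ⟨hP, hQ, hR, hS⟩ := hE
  have h1 := hQ.pd (i := 0)
  have h2 := hP.pd (i := 1)
  change ContDiffAt ℝ ∞ (fun p => dx E.Q p - dy E.P p + 2 * E.P p * E.R p - 2 * E.Q p ^ 2) p
  fun_prop

theorem SmoothAt.alpha1 (hE : E.SmoothAt p) : ContDiffAt ℝ ∞ E.alpha1 p := by
  obtain ⟨hP, hQ, hR, hS⟩ := hE
  have h1 := hR.pd (i := 0)
  have h2 := hQ.pd (i := 1)
  change ContDiffAt ℝ ∞ (fun p => dx E.R p - dy E.Q p + E.P p * E.S p - E.Q p * E.R p) p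
  fun_prop

theorem SmoothAt.alpha2 (hE : E.SmoothAt p) : ContDiffAt ℝ ∞ E.alpha2 p := by
  obtain ⟨hP, hQ, hR, hS⟩ := hE
  have h1 := hS.pd (i := 0)
  have h2 := hR.pd (i := 1)
  change ContDiffAt ℝ ∞ (fun p => dx E.S p - dy E.R p + 2 * E.Q p * E.S p - 2 * E.R p ^ 2) p
  fun_prop

theorem SmoothAt.beta1 (hE : E.SmoothAt p) : ContDiffAt ℝ ∞ E.beta1 p := by
  have h0 := hE.alpha0
  have h1 := hE.alpha1
  have h2 := hE.alpha2
  obtain ⟨hP, hQ, hR, hS⟩ := hE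
  have h3 := h1.pd (i := 0)
  have h4 := h0.pd (i := 1)
  change ContDiffAt ℝ ∞ (fun p => dx E.alpha1 p - dy E.alpha0 p + E.R p * E.alpha0 p
    - 2 * E.Q p * E.alpha1 p + E.P p * E.alpha2 p) p
  fun_prop

theorem SmoothAt.beta2 (hE : E.SmoothAt p) : ContDiffAt ℝ ∞ E.beta2 p := by
  have h0 := hE.alpha0
  have h1 := hE.alpha1
  have h2 := hE.alpha2
  obtain ⟨hP, hQ, hR, hS⟩ := hE
  have h3 := h2.pd (i := 0)
  have h4 := h1.pd (i := 1)
  change ContDiffAt ℝ ∞ (fun p => dx E.alpha2 p - dy E.alpha1 p + E.S p * E.alpha0 p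
    - 2 * E.R p * E.alpha1 p + E.Q p * E.alpha2 p) p
  fun_prop

theorem SmoothAt.beta1_eq (hE : E.SmoothAt p) : E.beta1 p = E.A p := by
  obtain ⟨hP, hQ, hR, hS⟩ := hE
  have h1 := hP.pd (i := 1)
  have h2 := hQ.pd (i := 0)
  have h3 := hQ.pd (i := 1)
  have h4 := hR.pd (i := 0)
  have h5 := pd_comm hQ
  have e0 : E.alpha0 = fun p => dx E.Q p - dy E.P p + 2 * E.P p * E.R p - 2 * E.Q p ^ 2 := rfl
  have e1 : E.alpha1 = fun p => dx E.R p - dy E.Q p + E.P p * E.S p - E.Q p * E.R p := rfl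
  unfold CubicODE.beta1 A
  simp only [CubicODE.alpha2]
  rw [e0, e1]
  simp (disch := fun_prop) only [dx, dy, pd_add, pd_sub, pd_mul, pd_pow, pd_const]
  linear_combination -h5

theorem SmoothAt.beta2_eq (hE : E.SmoothAt p) : E.beta2 p = E.B p := by
  obtain ⟨hP, hQ, hR, hS⟩ := hE
  have h1 := hR.pd (i := 1)
  have h2 := hS.pd (i := 0)
  have h3 := hQ.pd (i := 1)
  have h4 := hR.pd (i := 0)
  have h5 := pd_comm hR
  have e0 : E.alpha2 = fun p => dx E.S p - dy E.R p + 2 * E.Q p * E.S p - 2 * E.R p ^ 2 := rfl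
  have e1 : E.alpha1 = fun p => dx E.R p - dy E.Q p + E.P p * E.S p - E.Q p * E.R p := rfl
  unfold CubicODE.beta2 B
  simp only [CubicODE.alpha0]
  rw [e0, e1]
  simp (disch := fun_prop) only [dx, dy, pd_add, pd_sub, pd_mul, pd_pow, pd_const]
  linear_combination -h5

/-! ### Intermediate degeneration and the characterization of `φ` -/

/-- The equation is smooth and of intermediate degeneration near `p`. -/
def DegenerateAt (E : CubicODE) (p : ℝ × ℝ) : Prop :=
  ∀ᶠ z in 𝓝 p, E.SmoothAt z ∧ E.F5 z = 0 ∧ (E.beta1 z ≠ 0 ∨ E.beta2 z ≠ 0)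

/-- The symmetrized covariant derivative of `(β₁, β₂)`, a pseudocovector of weight one,
vanishes for the connection built from the covector `(u, v)`. -/
def IsCompatible (E : CubicODE) (p : ℝ × ℝ) (u v : ℝ) : Prop :=
  E.gamma10 p = -(5 / 3) * (u * E.beta1 p) ∧
  E.gamma20 p + E.gamma11 p = -(5 / 3) * (u * E.beta2 p + v * E.beta1 p) ∧
  E.gamma21 p = -(5 / 3) * (v * E.beta2 p)

theorem SmoothOn.degenerateAt {U : Set (ℝ × ℝ)} (hE : E.SmoothOn U) (hU : IsOpen U)
    (hdeg : E.IntermediateDegeneration U) (hp : p ∈ U) : E.DegenerateAt p := by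
  filter_upwards [hU.mem_nhds hp] with z hz
  have hs := hE.smoothAt hU hz
  obtain ⟨hF, hAB⟩ := hdeg z hz
  refine ⟨hs, ?_, ?_⟩
  · rw [← F_pow_five, hF]; norm_num
  · rwa [hs.beta1_eq, hs.beta2_eq]

theorem SmoothAt.eventually_eq (h : ∀ᶠ z in 𝓝 p, E.SmoothAt z) :
    E.A =ᶠ[𝓝 p] E.beta1 ∧ E.B =ᶠ[𝓝 p] E.beta2 :=
  ⟨h.mono fun _ h => h.beta1_eq.symm, h.mono fun _ h => h.beta2_eq.symm⟩

/-- The right side is minus the quadratic form of the covariant derivative of `(β₁, β₂)`, taken at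
the vector `(β₂, -β₁)` that this covector annihilates. -/
theorem F5_eq (h : ∀ᶠ z in 𝓝 p, E.SmoothAt z) :
    E.F5 p = -E.beta1 p ^ 2 * E.gamma21 p
      + E.beta1 p * E.beta2 p * (E.gamma20 p + E.gamma11 p) - E.beta2 p ^ 2 * E.gamma10 p := by
  obtain ⟨hA, hB⟩ := SmoothAt.eventually_eq h
  unfold F5 G H gamma10 gamma11 gamma20 gamma21
  simp only [dx, dy, pd_congr hA, pd_congr hB, hA.eq_of_nhds, hB.eq_of_nhds]
  ring

theorem IsCompatible.F5_eq_zero {u v : ℝ} (h : ∀ᶠ z in 𝓝 p, E.SmoothAt z)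
    (hc : E.IsCompatible p u v) : E.F5 p = 0 := by
  obtain ⟨h1, h2, h3⟩ := hc
  rw [F5_eq h, h1, h2, h3]
  ring

/-- A product of two linear forms determines one factor when the other is given and nonzero. -/
theorem IsCompatible.unique {u v u' v' : ℝ} (hb : E.beta1 p ≠ 0 ∨ E.beta2 p ≠ 0)
    (h : E.IsCompatible p u v) (h' : E.IsCompatible p u' v') : u = u' ∧ v = v' := by
  obtain ⟨h1, h2, h3⟩ := h
  obtain ⟨h1', h2', h3'⟩ := h'
  rcases hb with hb | hb
  · have hu : u = u' := mul_right_cancel₀ hb (by linarith)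
    subst hu
    exact ⟨rfl, mul_right_cancel₀ hb (by linarith)⟩
  · have hv : v = v' := mul_right_cancel₀ hb (by linarith)
    subst hv
    exact ⟨mul_right_cancel₀ hb (by linarith), rfl⟩

theorem DegenerateAt.eventually (h : E.DegenerateAt p) : ∀ᶠ z in 𝓝 p, E.DegenerateAt z :=
  eventually_eventually_nhds.2 h

theorem DegenerateAt.eventually_smoothAt (h : E.DegenerateAt p) : ∀ᶠ z in 𝓝 p, E.SmoothAt z :=
  h.mono fun _ h => h.1

theorem DegenerateAt.smoothAt (h : E.DegenerateAt p) : E.SmoothAt p :=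
  h.eventually_smoothAt.self_of_nhds

theorem DegenerateAt.isCompatible_phi (h : E.DegenerateAt p) :
    E.IsCompatible p (E.phi 0 p) (E.phi 1 p) := by
  obtain ⟨hs, h5, hb⟩ := h.self_of_nhds
  have hF := F5_eq h.eventually_smoothAt
  obtain ⟨hA, hB⟩ := SmoothAt.eventually_eq h.eventually_smoothAt
  rw [h5] at hF
  unfold IsCompatible
  unfold gamma10 gamma11 gamma20 gamma21 at *
  unfold phi
  simp only [ne_eq, dx, dy, pd_congr hA, pd_congr hB, hA.eq_of_nhds, hB.eq_of_nhds] at *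
  by_cases h1 : E.beta1 p = 0
  · have h2 : E.beta2 p ≠ 0 := by tauto
    simp only [h1, not_true_eq_false, if_false, Matrix.cons_val_zero, Matrix.cons_val_one] at hF ⊢
    -- When `β₁ = 0`, the equation `F5 = 0` reduces to `β₂² γ₁₀ = 0`, which is the first
    -- compatibility condition.
    have h3 : pd 0 E.beta1 p + E.P p * E.beta2 p = 0 := by
      have : E.beta2 p ^ 2 * (pd 0 E.beta1 p + E.P p * E.beta2 p) = 0 := by linarith
      simpa [h2] using this
    refine ⟨by linear_combination h3, ?_, ?_⟩ <;> field_simp <;> ring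
  · simp only [if_pos h1, Matrix.cons_val_zero, Matrix.cons_val_one]
    refine ⟨?_, ?_, ?_⟩
    · field_simp; ring
    · field_simp; ring
    · field_simp
      -- For `β₁ ≠ 0` the first two conditions amount to the definition of `φ`; only the third needs
      -- `F5 = 0`.
      linear_combination 3 * hF

/-- Since `β₁ = A`, the hypothesis `β₁ ≠ 0` keeps a single branch of `phi` in force on a
neighbourhood. -/
theorem DegenerateAt.contDiffAt_phi (h : E.DegenerateAt p) (hb : E.beta1 p ≠ 0) (i : Fin 2) :
    ContDiffAt ℝ ∞ (E.phi i) p := by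
  have hs := h.smoothAt
  have h1 := hs.beta1
  have h2 := hs.beta2
  obtain ⟨hA, hB⟩ := SmoothAt.eventually_eq h.eventually_smoothAt
  have hA1 := h1.congr_of_eventuallyEq hA
  have hB1 := h2.congr_of_eventuallyEq hB
  obtain ⟨hP, hQ, hR, hS⟩ := hs
  have hA0 : E.A p ≠ 0 := by rwa [hA.eq_of_nhds]
  have hA2 := hA1.pd (i := 0)
  have hA3 := hA1.pd (i := 1)
  have hB2 := hB1.pd (i := 0)
  have h5 : 5 * E.A p ≠ 0 := by positivity
  have h6 : 5 * E.A p ^ 2 ≠ 0 := by positivity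
  have hev : ∀ᶠ z in 𝓝 p, E.A z ≠ 0 := hA1.continuousAt.eventually_ne hA0
  fin_cases i
  · have : E.phi 0 =ᶠ[𝓝 p] fun p =>
        -3 * ((E.B p * E.P p + dx E.A p) / (5 * E.A p)) + 3 / 5 * E.Q p := by
      filter_upwards [hev] with z hz
      simp [phi, hz]
    refine ContDiffAt.congr_of_eventuallyEq ?_ this
    fun_prop (disch := assumption)
  · have : E.phi 1 =ᶠ[𝓝 p] fun p =>
      3 * E.B p * ((E.B p * E.P p + dx E.A p) / (5 * E.A p ^ 2))
        - 3 * ((dx E.B p + dy E.A p + 3 * E.B p * E.Q p) / (5 * E.A p)) + 6 / 5 * E.R p := by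
      filter_upwards [hev] with z hz
      simp [phi, hz]
    refine ContDiffAt.congr_of_eventuallyEq ?_ this
    fun_prop (disch := assumption)

/-! ### The Ricci tensor, `det curv` and `j5` -/

/-- Components of the symmetric part of the Ricci tensor of the connection `conn`. -/
def ric11 (E : CubicODE) (p : ℝ × ℝ) : ℝ :=
  E.alpha0 p + 1 / 3 * (dx (E.phi 0) p - E.Q p * E.phi 0 p + E.P p * E.phi 1 p)
    + 1 / 9 * E.phi 0 p ^ 2

/-- The mixed component of the symmetric part of the Ricci tensor. -/
def ric12 (E : CubicODE) (p : ℝ × ℝ) : ℝ :=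
  E.alpha1 p + 1 / 3 * ((dy (E.phi 0) p + dx (E.phi 1) p) / 2
    - E.R p * E.phi 0 p + E.Q p * E.phi 1 p) + 1 / 9 * (E.phi 0 p * E.phi 1 p)

/-- The `yy` component of the symmetric part of the Ricci tensor. -/
def ric22 (E : CubicODE) (p : ℝ × ℝ) : ℝ :=
  E.alpha2 p + 1 / 3 * (dy (E.phi 1) p - E.S p * E.phi 0 p + E.R p * E.phi 1 p)
    + 1 / 9 * E.phi 1 p ^ 2

/-- In dimension two the rows of `curv` are, up to order and sign, the columns of the Ricci tensor,
so the determinants agree. A skew part with entries `±w` adds `w²`, and here `w² = (3 Ω / 10)²`. -/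
theorem DegenerateAt.det_curv (h : E.DegenerateAt p) (hb : E.beta1 p ≠ 0) :
    (E.curv p).det = E.ric11 p * E.ric22 p - E.ric12 p ^ 2 + 9 / 100 * E.Omega p ^ 2 := by
  have hφ0 := h.contDiffAt_phi hb 0
  have hφ1 := h.contDiffAt_phi hb 1
  obtain ⟨hP, hQ, hR, hS⟩ := h.smoothAt
  have c000 : E.conn 0 0 0 = fun z => E.Q z - 2 / 3 * E.phi 0 z := by
    funext z; simp [conn, theta, thetaLow, dMat, Fin.sum_univ_two]; ring
  have c001 : E.conn 0 0 1 = fun z => E.R z - 1 / 3 * E.phi 1 z := by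
    funext z; simp [conn, theta, thetaLow, dMat, Fin.sum_univ_two]; ring
  have c010 : E.conn 0 1 0 = fun z => E.R z - 1 / 3 * E.phi 1 z := by
    funext z; simp [conn, theta, thetaLow, dMat, Fin.sum_univ_two]; ring
  have c011 : E.conn 0 1 1 = fun z => E.S z := by
    funext z; simp [conn, theta, thetaLow, dMat, Fin.sum_univ_two]
  have c100 : E.conn 1 0 0 = fun z => -E.P z := by
    funext z; simp [conn, theta, thetaLow, dMat, Fin.sum_univ_two]
  have c101 : E.conn 1 0 1 = fun z => -E.Q z - 1 / 3 * E.phi 0 z := by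
    funext z; simp [conn, theta, thetaLow, dMat, Fin.sum_univ_two]; ring
  have c110 : E.conn 1 1 0 = fun z => -E.Q z - 1 / 3 * E.phi 0 z := by
    funext z; simp [conn, theta, thetaLow, dMat, Fin.sum_univ_two]; ring
  have c111 : E.conn 1 1 1 = fun z => -E.R z - 2 / 3 * E.phi 1 z := by
    funext z; simp [conn, theta, thetaLow, dMat, Fin.sum_univ_two]; ring
  rw [Matrix.det_fin_two]
  simp only [curv, Matrix.of_apply, Omega, riem, Fin.sum_univ_two, c000, c001, c010, c011, c100,
    c101, c110, c111]
  simp (disch := fun_prop) only [pd_sub, pd_neg, pd_mul, pd_const]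
  simp only [dMat, ric11, ric12, ric22, alpha0, alpha1, alpha2, dx, dy, Matrix.of_apply,
    Matrix.cons_val', Matrix.cons_val_zero, Matrix.cons_val_one]
  ring

/-- The compatibility relations hold near `p`, hence may be differentiated. They and their
derivatives express three first and all second derivatives of `β₁, β₂` through `φ`; the identity is
then rational. -/
theorem DegenerateAt.j5_eq (h : E.DegenerateAt p) (hb : E.beta1 p ≠ 0) :
    E.j5 p = -125 * (E.ric11 p * E.ric22 p - E.ric12 p ^ 2) := by
  have hφ0 := h.contDiffAt_phi hb 0
  have hφ1 := h.contDiffAt_phi hb 1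
  have hs := h.smoothAt
  have hb1 := hs.beta1
  have hb2 := hs.beta2
  have hb1x := hb1.pd (i := 0)
  have hb1y := hb1.pd (i := 1)
  have hb2x := hb2.pd (i := 0)
  have hb2y := hb2.pd (i := 1)
  have s1 := pd_comm hb1
  have s2 := pd_comm hb2
  obtain ⟨hP, hQ, hR, hS⟩ := hs
  have g10 : E.gamma10 = fun p => dx E.beta1 p - E.Q p * E.beta1 p + E.P p * E.beta2 p := rfl
  have g11 : E.gamma11 = fun p => dx E.beta2 p - E.R p * E.beta1 p + E.Q p * E.beta2 p := rfl
  have g20 : E.gamma20 = fun p => dy E.beta1 p - E.R p * E.beta1 p + E.Q p * E.beta2 p := rfl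
  have g21 : E.gamma21 = fun p => dy E.beta2 p - E.S p * E.beta1 p + E.R p * E.beta2 p := rfl
  have hc : ∀ᶠ z in 𝓝 p, E.IsCompatible z (E.phi 0 z) (E.phi 1 z) :=
    h.eventually.mono fun _ h => h.isCompatible_phi
  obtain ⟨e1, e2, e3⟩ := hc.self_of_nhds
  have d1 : ∀ i, pd i E.gamma10 p = pd i (fun z => -(5 / 3) * (E.phi 0 z * E.beta1 z)) p :=
    fun i => pd_congr (hc.mono fun _ h => h.1)
  have d2 : ∀ i, pd i (fun z => E.gamma20 z + E.gamma11 z) p = pd i (fun z => -(5 / 3) *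
      (E.phi 0 z * E.beta2 z + E.phi 1 z * E.beta1 z)) p :=
    fun i => pd_congr (hc.mono fun _ h => h.2.1)
  have d3 : ∀ i, pd i E.gamma21 p = pd i (fun z => -(5 / 3) * (E.phi 1 z * E.beta2 z)) p :=
    fun i => pd_congr (hc.mono fun _ h => h.2.2)
  have d1x := d1 0
  have d1y := d1 1
  have d2x := d2 0
  have d2y := d2 1
  have d3x := d3 0
  have d3y := d3 1
  clear d1 d2 d3
  unfold j5 j1 j2 j3 j0 delta10 delta20 delta30 delta11
  unfold ric11 ric12 ric22
  rw [g10, g11, g20, g21] at *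
  simp (disch := fun_prop) only [dx, dy, pd_add, pd_sub, pd_neg, pd_mul, pd_const] at *
  simp only [alpha0, alpha1, alpha2, dx, dy]
  generalize pd 0 (pd 0 E.beta1) p = b1xx at *
  generalize pd 0 (pd 1 E.beta1) p = b1xy at *
  generalize pd 1 (pd 1 E.beta1) p = b1yy at *
  generalize pd 1 (pd 0 E.beta1) p = b1yx at *
  generalize pd 0 (pd 0 E.beta2) p = b2xx at *
  generalize pd 0 (pd 1 E.beta2) p = b2xy at *
  generalize pd 1 (pd 1 E.beta2) p = b2yy at *
  generalize pd 1 (pd 0 E.beta2) p = b2yx at *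
  subst s1 s2
  generalize pd 0 E.beta1 p = b1x at *
  generalize pd 1 E.beta1 p = b1y at *
  generalize pd 0 E.beta2 p = b2x at *
  generalize pd 1 E.beta2 p = b2y at *
  generalize E.beta1 p = b1 at *
  generalize E.beta2 p = b2 at *
  generalize pd 0 (E.phi 0) p = u0x at *
  generalize pd 1 (E.phi 0) p = u0y at *
  generalize pd 0 (E.phi 1) p = u1x at *
  generalize pd 1 (E.phi 1) p = u1y at *
  generalize E.phi 0 p = u0 at *
  generalize E.phi 1 p = u1 at *
  generalize pd 0 E.P p = Px at *
  generalize pd 1 E.P p = Py at *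
  generalize pd 0 E.Q p = Qx at *
  generalize pd 1 E.Q p = Qy at *
  generalize pd 0 E.R p = Rx at *
  generalize pd 1 E.R p = Ry at *
  generalize pd 0 E.S p = Sx at *
  generalize pd 1 E.S p = Sy at *
  generalize E.P p = P at *
  generalize E.Q p = Q at *
  generalize E.R p = R at *
  generalize E.S p = S at *
  clear g10 g11 g20 g21 hc hφ0 hφ1 hP hQ hR hS hb1 hb2 hb1x hb1y hb2x hb2y h
  -- The relations fix only the symmetrized derivative of `(β₁, β₂)`. The derivative `b1y` stays
  -- free and must cancel at the end.
  obtain rfl : b1x = Q * b1 - P * b2 - (5 / 3) * (u0 * b1) := by linear_combination e1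
  obtain rfl : b2x = 2 * R * b1 - 2 * Q * b2 - b1y - (5 / 3) * (u0 * b2 + u1 * b1) := by
    linear_combination e2
  obtain rfl : b2y = S * b1 - R * b2 - (5 / 3) * (u1 * b2) := by linear_combination e3
  clear e1 e2 e3
  simp only [neg_zero, mul_zero, add_zero] at d1x d1y d2x d2y d3x d3y
  rw [sub_add_eq_add_sub, sub_eq_iff_eq_add, ← eq_sub_iff_add_eq] at d1x d1y d3x d3y
  subst d1x d1y d3x d3y
  -- With `b1xy` and `b2xy` eliminated, the two remaining relations can be solved for `b2xx` and
  -- `b1yy`.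
  have d2x' := eq_sub_of_add_eq' d2x
  rw [sub_add_eq_add_sub, sub_eq_iff_eq_add, ← eq_sub_iff_add_eq] at d2x'
  have d2y' := eq_sub_of_add_eq d2y
  rw [sub_add_eq_add_sub, sub_eq_iff_eq_add, ← eq_sub_iff_add_eq] at d2y'
  clear d2x d2y
  subst d2x' d2y'
  field_simp
  ring

/-- The excluded slope, which is vertical in the new coordinates, is absorbed by multiplying by `a +
b * s`: the resulting quartic vanishes everywhere. -/
theorem cubic_coeff_eq_zero {a b c₀ c₁ c₂ c₃ : ℝ} (hab : a ≠ 0 ∨ b ≠ 0)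
    (h : ∀ s : ℝ, a + b * s ≠ 0 → c₀ + c₁ * s + c₂ * s ^ 2 + c₃ * s ^ 3 = 0) :
    c₀ = 0 ∧ c₁ = 0 ∧ c₂ = 0 ∧ c₃ = 0 := by
  have h' : ∀ s : ℝ, (a + b * s) * (c₀ + c₁ * s + c₂ * s ^ 2 + c₃ * s ^ 3) = 0 := fun s => by
    by_cases hs : a + b * s = 0
    · rw [hs, zero_mul]
    · rw [h s hs, mul_zero]
  have h0 := h' 0
  have h1 := h' 1
  have h2 := h' (-1)
  have h3 := h' 2
  have h4 := h' (-2)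
  -- Interpolation at `0, ±1, ±2` recovers the five coefficients of the quartic.
  have k0 : a * c₀ = 0 := by linear_combination h0
  have k1 : a * c₁ + b * c₀ = 0 := by linear_combination (8 * h1 - 8 * h2 - h3 + h4) / 12
  have k2 : a * c₂ + b * c₁ = 0 := by
    linear_combination (-30 * h0 + 16 * h1 + 16 * h2 - h3 - h4) / 24
  have k3 : a * c₃ + b * c₂ = 0 := by linear_combination (h3 - h4 - 2 * h1 + 2 * h2) / 12
  have k4 : b * c₃ = 0 := by linear_combination (6 * h0 - 4 * h1 - 4 * h2 + h3 + h4) / 24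
  rcases hab with ha | hb
  · obtain rfl : c₀ = 0 := by simpa [ha] using k0
    obtain rfl : c₁ = 0 := by simpa [ha] using k1
    obtain rfl : c₂ = 0 := by simpa [ha] using k2
    obtain rfl : c₃ = 0 := by simpa [ha] using k3
    simp
  · obtain rfl : c₃ = 0 := by simpa [hb] using k4
    obtain rfl : c₂ = 0 := by simpa [hb] using k3
    obtain rfl : c₁ = 0 := by simpa [hb] using k2
    obtain rfl : c₀ = 0 := by simpa [hb] using k1
    simp

end CubicODE

/-! ### The Jacobi matrix and its logarithmic derivative -/

section Jacobian

variable (Φ : ℝ × ℝ → ℝ × ℝ)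

/-- The entry `∂x̃/∂x` of the transition matrix. -/
def jacXx : ℝ × ℝ → ℝ := pd 0 fun z => (Φ z).1

/-- The entry `∂x̃/∂y` of the transition matrix. -/
def jacXy : ℝ × ℝ → ℝ := pd 1 fun z => (Φ z).1

/-- The entry `∂ỹ/∂x` of the transition matrix. -/
def jacYx : ℝ × ℝ → ℝ := pd 0 fun z => (Φ z).2

/-- The entry `∂ỹ/∂y` of the transition matrix. -/
def jacYy : ℝ × ℝ → ℝ := pd 1 fun z => (Φ z).2

/-- The Jacobi determinant. -/
def jacDet (p : ℝ × ℝ) : ℝ := jacXx Φ p * jacYy Φ p - jacXy Φ p * jacYx Φ p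

/-- One third of the logarithmic derivative of the Jacobi determinant. -/
def jacLog (i : Fin 2) (p : ℝ × ℝ) : ℝ := pd i (jacDet Φ) p / (3 * jacDet Φ p)

theorem det_transitionMatrix (p : ℝ × ℝ) : (transitionMatrix Φ p).det = jacDet Φ p := by
  rw [Matrix.det_fin_two]
  rfl

end Jacobian

section JacobianSmooth

variable {Φ : ℝ × ℝ → ℝ × ℝ} {p : ℝ × ℝ}

theorem ContDiffAt.jacXx (h : ContDiffAt ℝ ∞ Φ p) : ContDiffAt ℝ ∞ (jacXx Φ) p := h.fst.pd

theorem ContDiffAt.jacXy (h : ContDiffAt ℝ ∞ Φ p) : ContDiffAt ℝ ∞ (jacXy Φ) p := h.fst.pd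

theorem ContDiffAt.jacYx (h : ContDiffAt ℝ ∞ Φ p) : ContDiffAt ℝ ∞ (jacYx Φ) p := h.snd.pd

theorem ContDiffAt.jacYy (h : ContDiffAt ℝ ∞ Φ p) : ContDiffAt ℝ ∞ (jacYy Φ) p := h.snd.pd

theorem ContDiffAt.jacDet (h : ContDiffAt ℝ ∞ Φ p) : ContDiffAt ℝ ∞ (jacDet Φ) p :=
  (h.jacXx.mul h.jacYy).sub (h.jacXy.mul h.jacYx)

theorem ContDiffAt.jacLog (h : ContDiffAt ℝ ∞ Φ p) (hD : _root_.jacDet Φ p ≠ 0) (i : Fin 2) :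
    ContDiffAt ℝ ∞ (jacLog Φ i) p :=
  h.jacDet.pd.div (contDiffAt_const.mul h.jacDet) (by positivity)

theorem pd_zero_comp {f : ℝ × ℝ → ℝ} (hf : ContDiffAt ℝ ∞ f (Φ p)) (h : ContDiffAt ℝ ∞ Φ p) :
    pd 0 (fun z => f (Φ z)) p = jacXx Φ p * pd 0 f (Φ p) + jacYx Φ p * pd 1 f (Φ p) :=
  pd_comp hf h

theorem pd_one_comp {f : ℝ × ℝ → ℝ} (hf : ContDiffAt ℝ ∞ f (Φ p)) (h : ContDiffAt ℝ ∞ Φ p) :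
    pd 1 (fun z => f (Φ z)) p = jacXy Φ p * pd 0 f (Φ p) + jacYy Φ p * pd 1 f (Φ p) :=
  pd_comp hf h

end JacobianSmooth

/-! ### Transformation law of the Thomas connection -/

namespace CubicODE

/-- The law by which the Thomas connection of `E'` pulls back to that of `E` at `p`,
together with smoothness and invertibility of the change of variables. -/
structure PullbackAt (E E' : CubicODE) (Φ : ℝ × ℝ → ℝ × ℝ) (p : ℝ × ℝ) : Prop where
  smooth : E.SmoothAt p
  smooth' : E'.SmoothAt (Φ p)
  smoothMap : ContDiffAt ℝ ∞ Φ p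
  det_ne : jacDet Φ p ≠ 0
  Xxx : pd 0 (jacXx Φ) p = jacXx Φ p * E.Q p - jacXy Φ p * E.P p
    - (E'.Q (Φ p) * jacXx Φ p ^ 2 + 2 * E'.R (Φ p) * jacXx Φ p * jacYx Φ p
      + E'.S (Φ p) * jacYx Φ p ^ 2) + 2 * jacLog Φ 0 p * jacXx Φ p
  Xxy : pd 1 (jacXx Φ) p = jacXx Φ p * E.R p - jacXy Φ p * E.Q p
    - (E'.Q (Φ p) * jacXx Φ p * jacXy Φ p
      + E'.R (Φ p) * (jacXx Φ p * jacYy Φ p + jacXy Φ p * jacYx Φ p)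
      + E'.S (Φ p) * jacYx Φ p * jacYy Φ p)
    + jacLog Φ 0 p * jacXy Φ p + jacLog Φ 1 p * jacXx Φ p
  Xyy : pd 1 (jacXy Φ) p = jacXx Φ p * E.S p - jacXy Φ p * E.R p
    - (E'.Q (Φ p) * jacXy Φ p ^ 2 + 2 * E'.R (Φ p) * jacXy Φ p * jacYy Φ p
      + E'.S (Φ p) * jacYy Φ p ^ 2) + 2 * jacLog Φ 1 p * jacXy Φ p
  Yxx : pd 0 (jacYx Φ) p = jacYx Φ p * E.Q p - jacYy Φ p * E.P p
    + (E'.P (Φ p) * jacXx Φ p ^ 2 + 2 * E'.Q (Φ p) * jacXx Φ p * jacYx Φ p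
      + E'.R (Φ p) * jacYx Φ p ^ 2) + 2 * jacLog Φ 0 p * jacYx Φ p
  Yxy : pd 1 (jacYx Φ) p = jacYx Φ p * E.R p - jacYy Φ p * E.Q p
    + (E'.P (Φ p) * jacXx Φ p * jacXy Φ p
      + E'.Q (Φ p) * (jacXx Φ p * jacYy Φ p + jacXy Φ p * jacYx Φ p)
      + E'.R (Φ p) * jacYx Φ p * jacYy Φ p)
    + jacLog Φ 0 p * jacYy Φ p + jacLog Φ 1 p * jacYx Φ p
  Yyy : pd 1 (jacYy Φ) p = jacYx Φ p * E.S p - jacYy Φ p * E.R p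
    + (E'.P (Φ p) * jacXy Φ p ^ 2 + 2 * E'.Q (Φ p) * jacXy Φ p * jacYy Φ p
      + E'.R (Φ p) * jacYy Φ p ^ 2) + 2 * jacLog Φ 1 p * jacYy Φ p

variable {E E' : CubicODE} {Φ : ℝ × ℝ → ℝ × ℝ} {p : ℝ × ℝ}

theorem eq_zero_of_det_ne {a b c e x y : ℝ} (hD : a * e - b * c ≠ 0)
    (h₁ : a * x = c * y) (h₂ : b * x = e * y) : x = 0 ∧ y = 0 := by
  constructor <;> refine (mul_eq_zero.1 ?_).resolve_left hD
  · linear_combination e * h₁ - c * h₂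
  · linear_combination b * h₁ - a * h₂

theorem jac_xy_comm (hΦ : ContDiffAt ℝ ∞ Φ p) :
    pd 0 (jacXy Φ) p = pd 1 (jacXx Φ) p ∧ pd 0 (jacYy Φ) p = pd 1 (jacYx Φ) p :=
  ⟨(pd_comm hΦ.fst).symm, (pd_comm hΦ.snd).symm⟩

/-- Comparing coefficients in the slope gives four linear equations for the six second derivatives
of `Φ`. The two derivatives of the Jacobi determinant, which define `jacLog`, supply the other two.
-/
theorem TransformsTo.pullbackAt {U : Set (ℝ × ℝ)} (hU : IsOpen U) (hE : E.SmoothOn U)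
    {V : Set (ℝ × ℝ)} (hV : IsOpen V) (hE' : E'.SmoothOn V) (hΦ : IsPointTransformation Φ U V)
    (ht : E.TransformsTo Φ U E') (hp : p ∈ U) : E.PullbackAt E' Φ p := by
  obtain ⟨hΦs, hm, hd⟩ := hΦ
  have hs : ContDiffAt ℝ ∞ Φ p := hΦs.contDiffAt (hU.mem_nhds hp)
  have hD : jacDet Φ p ≠ 0 := det_transitionMatrix Φ p ▸ hd p hp
  have hDi : ∀ i, pd i (jacDet Φ) p = 3 * jacDet Φ p * jacLog Φ i p := fun i => by
    rw [jacLog]; field_simp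
  have h1 := hs.jacXx
  have h2 := hs.jacXy
  have h3 := hs.jacYx
  have h4 := hs.jacYy
  obtain ⟨cX, cY⟩ := jac_xy_comm hs
  have hD' : jacDet Φ = fun p => jacXx Φ p * jacYy Φ p - jacXy Φ p * jacYx Φ p := rfl
  have hDx := hDi 0
  have hDy := hDi 1
  rw [hD'] at hDx hDy hD
  simp (disch := fun_prop) only [pd_sub, pd_mul, cX, cY] at hDx hDy
  have hab : jacXx Φ p ≠ 0 ∨ jacXy Φ p ≠ 0 := by
    by_contra! h
    exact hD (by simp [h.1, h.2])
  have hq := ht p hp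
  simp only [totalDeriv, totalDeriv2, newSecond, newSlope, rhs, dx, dy] at hq
  change ∀ s w : ℝ, jacXx Φ p + jacXy Φ p * s ≠ 0 → (w = _ ↔
    ((jacXx Φ p + jacXy Φ p * s) * (pd 0 (jacYx Φ) p + 2 * pd 0 (jacYy Φ) p * s
        + pd 1 (jacYy Φ) p * s ^ 2 + jacYy Φ p * w)
      - (jacYx Φ p + jacYy Φ p * s) * (pd 0 (jacXx Φ) p + 2 * pd 0 (jacXy Φ) p * s
        + pd 1 (jacXy Φ) p * s ^ 2 + jacXy Φ p * w)) / (jacXx Φ p + jacXy Φ p * s) ^ 3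
    = E'.P (Φ p)
      + 3 * E'.Q (Φ p) * ((jacYx Φ p + jacYy Φ p * s) / (jacXx Φ p + jacXy Φ p * s))
      + 3 * E'.R (Φ p) * ((jacYx Φ p + jacYy Φ p * s) / (jacXx Φ p + jacXy Φ p * s)) ^ 2
      + E'.S (Φ p) * ((jacYx Φ p + jacYy Φ p * s) / (jacXx Φ p + jacXy Φ p * s)) ^ 3) at hq
  rw [cX, cY] at hq
  have key : ∀ s : ℝ, jacXx Φ p + jacXy Φ p * s ≠ 0 →
      ((jacXx Φ p * jacYy Φ p - jacXy Φ p * jacYx Φ p) * E.P p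
        - (E'.P (Φ p) * jacXx Φ p ^ 3 + 3 * E'.Q (Φ p) * jacXx Φ p ^ 2 * jacYx Φ p
          + 3 * E'.R (Φ p) * jacXx Φ p * jacYx Φ p ^ 2 + E'.S (Φ p) * jacYx Φ p ^ 3)
        + jacXx Φ p * pd 0 (jacYx Φ) p - jacYx Φ p * pd 0 (jacXx Φ) p)
      + (3 * (jacXx Φ p * jacYy Φ p - jacXy Φ p * jacYx Φ p) * E.Q p
        - 3 * (E'.P (Φ p) * jacXx Φ p ^ 2 * jacXy Φ p
          + E'.Q (Φ p) * (jacXx Φ p ^ 2 * jacYy Φ p + 2 * jacXx Φ p * jacXy Φ p * jacYx Φ p)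
          + E'.R (Φ p) * (jacXy Φ p * jacYx Φ p ^ 2 + 2 * jacXx Φ p * jacYx Φ p * jacYy Φ p)
          + E'.S (Φ p) * jacYx Φ p ^ 2 * jacYy Φ p)
        + jacXy Φ p * pd 0 (jacYx Φ) p + 2 * jacXx Φ p * pd 1 (jacYx Φ) p
        - jacYy Φ p * pd 0 (jacXx Φ) p - 2 * jacYx Φ p * pd 1 (jacXx Φ) p) * s
      + (3 * (jacXx Φ p * jacYy Φ p - jacXy Φ p * jacYx Φ p) * E.R p
        - 3 * (E'.P (Φ p) * jacXx Φ p * jacXy Φ p ^ 2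
          + E'.Q (Φ p) * (jacXy Φ p ^ 2 * jacYx Φ p + 2 * jacXx Φ p * jacXy Φ p * jacYy Φ p)
          + E'.R (Φ p) * (jacXx Φ p * jacYy Φ p ^ 2 + 2 * jacXy Φ p * jacYx Φ p * jacYy Φ p)
          + E'.S (Φ p) * jacYx Φ p * jacYy Φ p ^ 2)
        + jacXx Φ p * pd 1 (jacYy Φ) p + 2 * jacXy Φ p * pd 1 (jacYx Φ) p
        - jacYx Φ p * pd 1 (jacXy Φ) p - 2 * jacYy Φ p * pd 1 (jacXx Φ) p) * s ^ 2
      + ((jacXx Φ p * jacYy Φ p - jacXy Φ p * jacYx Φ p) * E.S p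
        - (E'.P (Φ p) * jacXy Φ p ^ 3 + 3 * E'.Q (Φ p) * jacXy Φ p ^ 2 * jacYy Φ p
          + 3 * E'.R (Φ p) * jacXy Φ p * jacYy Φ p ^ 2 + E'.S (Φ p) * jacYy Φ p ^ 3)
        + jacXy Φ p * pd 1 (jacYy Φ) p - jacYy Φ p * pd 1 (jacXy Φ) p) * s ^ 3 = 0 := by
    intro s hs
    -- Only the jet of `E` itself is needed, so `w` is set to the value of `E.rhs p s`.
    have := (hq s _ hs).1 rfl
    rw [div_eq_iff (pow_ne_zero 3 hs)] at this
    have e2 : ∀ k : ℝ, E'.P (Φ p) + 3 * E'.Q (Φ p) * (k / (jacXx Φ p + jacXy Φ p * s))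
        + 3 * E'.R (Φ p) * (k / (jacXx Φ p + jacXy Φ p * s)) ^ 2
        + E'.S (Φ p) * (k / (jacXx Φ p + jacXy Φ p * s)) ^ 3 =
        (E'.P (Φ p) * (jacXx Φ p + jacXy Φ p * s) ^ 3
          + 3 * E'.Q (Φ p) * k * (jacXx Φ p + jacXy Φ p * s) ^ 2
          + 3 * E'.R (Φ p) * k ^ 2 * (jacXx Φ p + jacXy Φ p * s)
          + E'.S (Φ p) * k ^ 3) / (jacXx Φ p + jacXy Φ p * s) ^ 3 := fun k => by
      field_simp
    rw [e2, div_mul_cancel₀ _ (pow_ne_zero 3 hs)] at this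
    linear_combination this
  obtain ⟨k0, k1, k2, k3⟩ := cubic_coeff_eq_zero hab key
  -- Here `x` and `y` are the defects of the laws for `ỹ` and `x̃`. The six equations split into
  -- three pairs, each with the transposed Jacobi matrix up to sign.
  have hxx := eq_zero_of_det_ne hD
    (x := pd 0 (jacYx Φ) p - (jacYx Φ p * E.Q p - jacYy Φ p * E.P p
      + (E'.P (Φ p) * jacXx Φ p ^ 2 + 2 * E'.Q (Φ p) * jacXx Φ p * jacYx Φ p
        + E'.R (Φ p) * jacYx Φ p ^ 2) + 2 * jacLog Φ 0 p * jacYx Φ p))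
    (y := pd 0 (jacXx Φ) p - (jacXx Φ p * E.Q p - jacXy Φ p * E.P p
      - (E'.Q (Φ p) * jacXx Φ p ^ 2 + 2 * E'.R (Φ p) * jacXx Φ p * jacYx Φ p
        + E'.S (Φ p) * jacYx Φ p ^ 2) + 2 * jacLog Φ 0 p * jacXx Φ p))
    (by linear_combination k0) (by linear_combination (k1 - 2 * hDx) / 3)
  have hxy := eq_zero_of_det_ne hD
    (x := pd 1 (jacYx Φ) p - (jacYx Φ p * E.R p - jacYy Φ p * E.Q p
      + (E'.P (Φ p) * jacXx Φ p * jacXy Φ p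
        + E'.Q (Φ p) * (jacXx Φ p * jacYy Φ p + jacXy Φ p * jacYx Φ p)
        + E'.R (Φ p) * jacYx Φ p * jacYy Φ p)
      + jacLog Φ 0 p * jacYy Φ p + jacLog Φ 1 p * jacYx Φ p))
    (y := pd 1 (jacXx Φ) p - (jacXx Φ p * E.R p - jacXy Φ p * E.Q p
      - (E'.Q (Φ p) * jacXx Φ p * jacXy Φ p
        + E'.R (Φ p) * (jacXx Φ p * jacYy Φ p + jacXy Φ p * jacYx Φ p)
        + E'.S (Φ p) * jacYx Φ p * jacYy Φ p)
      + jacLog Φ 0 p * jacXy Φ p + jacLog Φ 1 p * jacXx Φ p))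
    (by linear_combination (k1 + hDx) / 3) (by linear_combination (k2 - hDy) / 3)
  have hyy := eq_zero_of_det_ne hD
    (x := pd 1 (jacYy Φ) p - (jacYx Φ p * E.S p - jacYy Φ p * E.R p
      + (E'.P (Φ p) * jacXy Φ p ^ 2 + 2 * E'.Q (Φ p) * jacXy Φ p * jacYy Φ p
        + E'.R (Φ p) * jacYy Φ p ^ 2) + 2 * jacLog Φ 1 p * jacYy Φ p))
    (y := pd 1 (jacXy Φ) p - (jacXx Φ p * E.S p - jacXy Φ p * E.R p
      - (E'.Q (Φ p) * jacXy Φ p ^ 2 + 2 * E'.R (Φ p) * jacXy Φ p * jacYy Φ p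
        + E'.S (Φ p) * jacYy Φ p ^ 2) + 2 * jacLog Φ 1 p * jacXy Φ p))
    (by linear_combination (k2 + 2 * hDy) / 3) (by linear_combination k3)
  exact ⟨hE.smoothAt hU hp, hE'.smoothAt hV (hm hp), hs, hD, sub_eq_zero.1 hxx.2,
    sub_eq_zero.1 hxy.2, sub_eq_zero.1 hyy.2, sub_eq_zero.1 hxx.1, sub_eq_zero.1 hxy.1,
    sub_eq_zero.1 hyy.1⟩

/-! ### Integrability conditions and the invariance of `φ` -/

/-- This is the integrability condition of the law for the second derivatives of `Φ`: equal mixed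
third derivatives compare the two Ricci tensors. -/
theorem PullbackAt.jacLog_law (h : ∀ᶠ z in 𝓝 p, E.PullbackAt E' Φ z) :
    pd 0 (jacLog Φ 0) p = jacLog Φ 0 p ^ 2 + E.Q p * jacLog Φ 0 p - E.P p * jacLog Φ 1 p
      + E.alpha0 p - (jacXx Φ p ^ 2 * E'.alpha0 (Φ p)
        + 2 * jacXx Φ p * jacYx Φ p * E'.alpha1 (Φ p) + jacYx Φ p ^ 2 * E'.alpha2 (Φ p)) ∧
    pd 1 (jacLog Φ 0) p = jacLog Φ 0 p * jacLog Φ 1 p + E.R p * jacLog Φ 0 p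
      - E.Q p * jacLog Φ 1 p + E.alpha1 p - (jacXx Φ p * jacXy Φ p * E'.alpha0 (Φ p)
        + (jacXx Φ p * jacYy Φ p + jacXy Φ p * jacYx Φ p) * E'.alpha1 (Φ p)
        + jacYx Φ p * jacYy Φ p * E'.alpha2 (Φ p)) ∧
    pd 0 (jacLog Φ 1) p = jacLog Φ 0 p * jacLog Φ 1 p + E.R p * jacLog Φ 0 p
      - E.Q p * jacLog Φ 1 p + E.alpha1 p - (jacXx Φ p * jacXy Φ p * E'.alpha0 (Φ p)
        + (jacXx Φ p * jacYy Φ p + jacXy Φ p * jacYx Φ p) * E'.alpha1 (Φ p)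
        + jacYx Φ p * jacYy Φ p * E'.alpha2 (Φ p)) ∧
    pd 1 (jacLog Φ 1) p = jacLog Φ 1 p ^ 2 + E.S p * jacLog Φ 0 p - E.R p * jacLog Φ 1 p
      + E.alpha2 p - (jacXy Φ p ^ 2 * E'.alpha0 (Φ p)
        + 2 * jacXy Φ p * jacYy Φ p * E'.alpha1 (Φ p) + jacYy Φ p ^ 2 * E'.alpha2 (Φ p)) := by
  have hp := h.self_of_nhds
  have hs := hp.smoothMap
  have h1 := hs.jacXx
  have h2 := hs.jacXy
  have h3 := hs.jacYx
  have h4 := hs.jacYy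
  have h5 := hs.jacLog hp.det_ne 0
  have h6 := hs.jacLog hp.det_ne 1
  have hD := hp.det_ne
  obtain ⟨hP, hQ, hR, hS⟩ := hp.smooth
  obtain ⟨hP', hQ', hR', hS'⟩ := hp.smooth'
  have cP := pd_zero_comp hP' hs
  have cQ := pd_zero_comp hQ' hs
  have cR := pd_zero_comp hR' hs
  have cS := pd_zero_comp hS' hs
  have dP := pd_one_comp hP' hs
  have dQ := pd_one_comp hQ' hs
  have dR := pd_one_comp hR' hs
  have dS := pd_one_comp hS' hs
  have sP : ContDiffAt ℝ ∞ (fun z => E'.P (Φ z)) p := hP'.comp p hs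
  have sQ : ContDiffAt ℝ ∞ (fun z => E'.Q (Φ z)) p := hQ'.comp p hs
  have sR : ContDiffAt ℝ ∞ (fun z => E'.R (Φ z)) p := hR'.comp p hs
  have sS : ContDiffAt ℝ ∞ (fun z => E'.S (Φ z)) p := hS'.comp p hs
  obtain ⟨cX, cY⟩ := jac_xy_comm hs
  have I1 := pd_comm h1
  have I2 := pd_comm h2
  have I3 := pd_comm h3
  have I4 := pd_comm h4
  rw [pd_congr (h.mono fun _ h => h.Xxx), pd_congr (h.mono fun _ h => h.Xxy)] at I1
  rw [pd_congr (h.mono fun _ h => (jac_xy_comm h.smoothMap).1.trans h.Xxy),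
    pd_congr (h.mono fun _ h => h.Xyy)] at I2
  rw [pd_congr (h.mono fun _ h => h.Yxx), pd_congr (h.mono fun _ h => h.Yxy)] at I3
  rw [pd_congr (h.mono fun _ h => (jac_xy_comm h.smoothMap).2.trans h.Yxy),
    pd_congr (h.mono fun _ h => h.Yyy)] at I4
  simp (disch := fun_prop) only [pd_add, pd_sub, pd_mul, pd_pow, pd_const, cP, cQ, cR, cS,
    dP, dQ, dR, dS, cX, cY, hp.Xxx, hp.Xxy, hp.Xyy, hp.Yxx, hp.Yxy, hp.Yyy] at I1 I2 I3 I4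
  simp only [alpha0, alpha1, alpha2, dx, dy]
  unfold jacDet at hD
  generalize pd 0 (jacLog Φ 0) p = v00 at *
  generalize pd 1 (jacLog Φ 0) p = v01 at *
  generalize pd 0 (jacLog Φ 1) p = v10 at *
  generalize pd 1 (jacLog Φ 1) p = v11 at *
  generalize jacLog Φ 0 p = v0 at *
  generalize jacLog Φ 1 p = v1 at *
  clear h hp cP cQ cR cS dP dQ dR dS sP sQ sR sS hP hQ hR hS hP' hQ' hR' hS' h1 h2 h3 h4 h5 h6
    cX cY hs
  generalize pd 0 E.P p = Px at *
  generalize pd 1 E.P p = Py at *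
  generalize pd 0 E.Q p = Qx at *
  generalize pd 1 E.Q p = Qy at *
  generalize pd 0 E.R p = Rx at *
  generalize pd 1 E.R p = Ry at *
  generalize pd 0 E.S p = Sx at *
  generalize pd 1 E.S p = Sy at *
  generalize E.P p = P at *
  generalize E.Q p = Q at *
  generalize E.R p = R at *
  generalize E.S p = S at *
  generalize pd 0 E'.P (Φ p) = Px' at *
  generalize pd 1 E'.P (Φ p) = Py' at *
  generalize pd 0 E'.Q (Φ p) = Qx' at *
  generalize pd 1 E'.Q (Φ p) = Qy' at *
  generalize pd 0 E'.R (Φ p) = Rx' at *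
  generalize pd 1 E'.R (Φ p) = Ry' at *
  generalize pd 0 E'.S (Φ p) = Sx' at *
  generalize pd 1 E'.S (Φ p) = Sy' at *
  generalize E'.P (Φ p) = P' at *
  generalize E'.Q (Φ p) = Q' at *
  generalize E'.R (Φ p) = R' at *
  generalize E'.S (Φ p) = S' at *
  generalize jacXx Φ p = a at *
  generalize jacXy Φ p = b at *
  generalize jacYx Φ p = c at *
  generalize jacYy Φ p = e at *
  have hD' : a * e - c * b ≠ 0 := by rwa [mul_comm c b]
  -- The `W`s are the defects of the four claims. The integrability conditions force `W00`, `W11`,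
  -- `2 * W01 - W10` and `2 * W10 - W01` to vanish, hence all four.
  obtain ⟨W00, h00⟩ : ∃ w, w = v00 - (v0 ^ 2 + Q * v0 - P * v1 + (Qx - Py + 2 * P * R - 2 * Q ^ 2)
      - (a ^ 2 * (Qx' - Py' + 2 * P' * R' - 2 * Q' ^ 2)
        + 2 * a * c * (Rx' - Qy' + P' * S' - Q' * R')
        + c ^ 2 * (Sx' - Ry' + 2 * Q' * S' - 2 * R' ^ 2))) := ⟨_, rfl⟩
  obtain ⟨W01, h01⟩ : ∃ w, w = v01 - (v0 * v1 + R * v0 - Q * v1 + (Rx - Qy + P * S - Q * R)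
      - (a * b * (Qx' - Py' + 2 * P' * R' - 2 * Q' ^ 2)
        + (a * e + b * c) * (Rx' - Qy' + P' * S' - Q' * R')
        + c * e * (Sx' - Ry' + 2 * Q' * S' - 2 * R' ^ 2))) := ⟨_, rfl⟩
  obtain ⟨W10, h10⟩ : ∃ w, w = v10 - (v0 * v1 + R * v0 - Q * v1 + (Rx - Qy + P * S - Q * R)
      - (a * b * (Qx' - Py' + 2 * P' * R' - 2 * Q' ^ 2)
        + (a * e + b * c) * (Rx' - Qy' + P' * S' - Q' * R')
        + c * e * (Sx' - Ry' + 2 * Q' * S' - 2 * R' ^ 2))) := ⟨_, rfl⟩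
  obtain ⟨W11, h11⟩ : ∃ w, w = v11 - (v1 ^ 2 + S * v0 - R * v1 + (Sx - Ry + 2 * Q * S - 2 * R ^ 2)
      - (b ^ 2 * (Qx' - Py' + 2 * P' * R' - 2 * Q' ^ 2)
        + 2 * b * e * (Rx' - Qy' + P' * S' - Q' * R')
        + e ^ 2 * (Sx' - Ry' + 2 * Q' * S' - 2 * R' ^ 2))) := ⟨_, rfl⟩
  have w1 := eq_zero_of_det_ne hD' (x := 2 * W01 - W10) (y := W00)
    (by rw [h00, h01, h10]; linear_combination I1) (by rw [h00, h01, h10]; linear_combination I3)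
  have w2 := eq_zero_of_det_ne hD' (x := W11) (y := 2 * W10 - W01)
    (by rw [h11, h01, h10]; linear_combination I2) (by rw [h11, h01, h10]; linear_combination I4)
  exact ⟨by linarith [w1.2], by linarith [w1.1, w2.2], by linarith [w1.1, w2.2],
    by linarith [w2.1]⟩

/-- Equal mixed derivatives of `jacLog` compare the curls of the two Ricci tensors. The skew index
pair contributes the factor `jacDet`. -/
theorem PullbackAt.beta_law (h : ∀ᶠ z in 𝓝 p, E.PullbackAt E' Φ z) :
    E.beta1 p = jacDet Φ p * (jacXx Φ p * E'.beta1 (Φ p) + jacYx Φ p * E'.beta2 (Φ p)) ∧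
    E.beta2 p = jacDet Φ p * (jacXy Φ p * E'.beta1 (Φ p) + jacYy Φ p * E'.beta2 (Φ p)) := by
  have hp := h.self_of_nhds
  have hs := hp.smoothMap
  have h1 := hs.jacXx
  have h2 := hs.jacXy
  have h3 := hs.jacYx
  have h4 := hs.jacYy
  have h5 := hs.jacLog hp.det_ne 0
  have h6 := hs.jacLog hp.det_ne 1
  have ha0 := hp.smooth.alpha0
  have ha1 := hp.smooth.alpha1
  have ha2 := hp.smooth.alpha2
  have ha0' := hp.smooth'.alpha0
  have ha1' := hp.smooth'.alpha1
  have ha2' := hp.smooth'.alpha2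
  obtain ⟨hP, hQ, hR, hS⟩ := hp.smooth
  have c0 := pd_zero_comp ha0' hs
  have c1 := pd_zero_comp ha1' hs
  have c2 := pd_zero_comp ha2' hs
  have d0 := pd_one_comp ha0' hs
  have d1 := pd_one_comp ha1' hs
  have d2 := pd_one_comp ha2' hs
  have s0 : ContDiffAt ℝ ∞ (fun z => E'.alpha0 (Φ z)) p := ha0'.comp p hs
  have s1 : ContDiffAt ℝ ∞ (fun z => E'.alpha1 (Φ z)) p := ha1'.comp p hs
  have s2 : ContDiffAt ℝ ∞ (fun z => E'.alpha2 (Φ z)) p := ha2'.comp p hs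
  obtain ⟨cX, cY⟩ := jac_xy_comm hs
  have hl := h.eventually_nhds.mono fun _ => PullbackAt.jacLog_law
  obtain ⟨l00, l01, l10, l11⟩ := hl.self_of_nhds
  have I1 := pd_comm h5
  have I2 := pd_comm h6
  rw [pd_congr (hl.mono fun _ h => h.1), pd_congr (hl.mono fun _ h => h.2.1)] at I1
  rw [pd_congr (hl.mono fun _ h => h.2.2.1), pd_congr (hl.mono fun _ h => h.2.2.2)] at I2
  simp (disch := fun_prop) only [pd_add, pd_sub, pd_mul, pd_pow, pd_const, c0, c1, c2,
    d0, d1, d2, cX, cY, l00, l01, l10, l11, hp.Xxx, hp.Xxy, hp.Xyy, hp.Yxx, hp.Yxy, hp.Yyy]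
    at I1 I2
  have a0 : E.alpha0 p = pd 0 E.Q p - pd 1 E.P p + 2 * E.P p * E.R p - 2 * E.Q p ^ 2 := rfl
  have a1 : E.alpha1 p = pd 0 E.R p - pd 1 E.Q p + E.P p * E.S p - E.Q p * E.R p := rfl
  have a2 : E.alpha2 p = pd 0 E.S p - pd 1 E.R p + 2 * E.Q p * E.S p - 2 * E.R p ^ 2 := rfl
  rw [a0, a1, a2] at I1 I2
  simp only [beta1, beta2, jacDet, dx, dy, a0, a1, a2]
  constructor
  · linear_combination -I1
  · linear_combination -I2

theorem PullbackAt.isCompatible_iff (h : ∀ᶠ z in 𝓝 p, E.PullbackAt E' Φ z) (u v : ℝ) :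
    E.IsCompatible p (jacXx Φ p * u + jacYx Φ p * v - 3 * jacLog Φ 0 p)
      (jacXy Φ p * u + jacYy Φ p * v - 3 * jacLog Φ 1 p) ↔ E'.IsCompatible (Φ p) u v := by
  have hp := h.self_of_nhds
  have hs := hp.smoothMap
  have h1 := hs.jacXx
  have h2 := hs.jacXy
  have h3 := hs.jacYx
  have h4 := hs.jacYy
  have h5 := hs.jacDet
  have hb1' := hp.smooth'.beta1
  have hb2' := hp.smooth'.beta2
  have c1 := pd_zero_comp hb1' hs
  have c2 := pd_zero_comp hb2' hs
  have d1 := pd_one_comp hb1' hs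
  have d2 := pd_one_comp hb2' hs
  have s1 : ContDiffAt ℝ ∞ (fun z => E'.beta1 (Φ z)) p := hb1'.comp p hs
  have s2 : ContDiffAt ℝ ∞ (fun z => E'.beta2 (Φ z)) p := hb2'.comp p hs
  have hD := hp.det_ne
  have hDi : ∀ i, pd i (jacDet Φ) p = 3 * jacDet Φ p * jacLog Φ i p := fun i => by
    rw [jacLog]; field_simp
  obtain ⟨cX, cY⟩ := jac_xy_comm hs
  have hl := h.eventually_nhds.mono fun _ => PullbackAt.beta_law
  obtain ⟨l1, l2⟩ := hl.self_of_nhds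
  have e1 := fun i => pd_congr (i := i) (hl.mono fun _ h => h.1)
  have e2 := fun i => pd_congr (i := i) (hl.mono fun _ h => h.2)
  have e10 := e1 0
  have e11 := e1 1
  have e20 := e2 0
  have e21 := e2 1
  simp (disch := fun_prop) only [pd_add, pd_mul, c1, c2,
    d1, d2, cX, cY, hDi, hp.Xxx, hp.Xxy, hp.Xyy, hp.Yxx, hp.Yxy, hp.Yyy] at e10 e11 e20 e21
  simp only [IsCompatible, gamma10, gamma11, gamma20, gamma21, dx, dy, e10, e11, e20, e21, l1, l2]
  have hD' : jacXx Φ p * jacYy Φ p - jacXy Φ p * jacYx Φ p ≠ 0 := hD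
  constructor
  · rintro ⟨k1, k2, k3⟩
    -- The conditions for `E` are the pullback of a quadratic form, times `jacDet`. The adjugate
    -- matrix undoes the pullback at the cost of the squared determinant.
    refine ⟨?_, ?_, ?_⟩ <;>
      refine sub_eq_zero.1 ((mul_eq_zero.1 ?_).resolve_left
        (mul_ne_zero hD (pow_ne_zero 2 hD')))
    · linear_combination jacYy Φ p ^ 2 * k1 - jacYy Φ p * jacYx Φ p * k2 + jacYx Φ p ^ 2 * k3
    · linear_combination -2 * jacYy Φ p * jacXy Φ p * k1
        + (jacXx Φ p * jacYy Φ p + jacXy Φ p * jacYx Φ p) * k2 - 2 * jacYx Φ p * jacXx Φ p * k3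
    · linear_combination jacXy Φ p ^ 2 * k1 - jacXx Φ p * jacXy Φ p * k2 + jacXx Φ p ^ 2 * k3
  · rintro ⟨k1, k2, k3⟩
    refine ⟨?_, ?_, ?_⟩
    · linear_combination jacDet Φ p * (jacXx Φ p ^ 2 * k1 + jacXx Φ p * jacYx Φ p * k2
        + jacYx Φ p ^ 2 * k3)
    · linear_combination jacDet Φ p * (2 * jacXx Φ p * jacXy Φ p * k1
        + (jacXx Φ p * jacYy Φ p + jacXy Φ p * jacYx Φ p) * k2
        + 2 * jacYx Φ p * jacYy Φ p * k3)
    · linear_combination jacDet Φ p * (jacXy Φ p ^ 2 * k1 + jacXy Φ p * jacYy Φ p * k2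
        + jacYy Φ p ^ 2 * k3)

theorem map_nhds_eq_of_jacDet_ne_zero (hs : ContDiffAt ℝ ∞ Φ p) (hD : jacDet Φ p ≠ 0) :
    map Φ (𝓝 p) = 𝓝 (Φ p) := by
  have hst : HasStrictFDerivAt Φ (fderiv ℝ Φ p) p := hs.hasStrictFDerivAt (by simp)
  have hΦ' := hs.differentiableAt (by simp : (∞ : WithTop ℕ∞) ≠ 0)
  have h1 : ∀ u, fderiv ℝ (fun z => (Φ z).1) p u = (fderiv ℝ Φ p u).1 := fun u => by
    rw [hΦ'.hasFDerivAt.fst.fderiv]; rfl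
  have h2 : ∀ u, fderiv ℝ (fun z => (Φ z).2) p u = (fderiv ℝ Φ p u).2 := fun u => by
    rw [hΦ'.hasFDerivAt.snd.fderiv]; rfl
  refine hst.map_nhds_eq_of_surj ?_
  rw [LinearMap.range_eq_top]
  rintro ⟨x, y⟩
  refine ⟨((jacYy Φ p * x - jacXy Φ p * y) / jacDet Φ p) • ((1 : ℝ), (0 : ℝ))
    + ((jacXx Φ p * y - jacYx Φ p * x) / jacDet Φ p) • ((0 : ℝ), (1 : ℝ)), ?_⟩
  have hDe : jacDet Φ p = jacXx Φ p * jacYy Φ p - jacXy Φ p * jacYx Φ p := rfl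
  have f1 : (fderiv ℝ Φ p ((1 : ℝ), (0 : ℝ))) = (jacXx Φ p, jacYx Φ p) :=
    Prod.ext (h1 _).symm (h2 _).symm
  have f2 : (fderiv ℝ Φ p ((0 : ℝ), (1 : ℝ))) = (jacXy Φ p, jacYy Φ p) :=
    Prod.ext (h1 _).symm (h2 _).symm
  simp only [map_add, map_smul, ContinuousLinearMap.coe_coe, f1, f2]
  ext
  · simp only [Prod.smul_mk, smul_eq_mul, Prod.mk_add_mk]
    field_simp
    rw [hDe]; ring
  · simp only [Prod.smul_mk, smul_eq_mul, Prod.mk_add_mk]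
    field_simp
    rw [hDe]; ring

/-- Degeneration is assumed for `E` only. It passes to a full neighbourhood of `Φ p` because `Φ` is
locally open. -/
theorem PullbackAt.degenerateAt (h : ∀ᶠ z in 𝓝 p, E.PullbackAt E' Φ z) (hE : E.DegenerateAt p) :
    E'.DegenerateAt (Φ p) := by
  have hp := h.self_of_nhds
  have hsm : ∀ᶠ q in 𝓝 (Φ p), E'.SmoothAt q := by
    rw [← map_nhds_eq_of_jacDet_ne_zero hp.smoothMap hp.det_ne]
    exact h.mono fun _ h => h.smooth'
  unfold DegenerateAt
  rw [← map_nhds_eq_of_jacDet_ne_zero hp.smoothMap hp.det_ne, eventually_map]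
  have hsm' := hp.smoothMap.continuousAt.eventually hsm.eventually_nhds
  filter_upwards [h.eventually_nhds, hE.eventually, hsm'] with z hz hEz hsz
  have hpz := hz.self_of_nhds
  have hD := hpz.det_ne
  have hDe : jacDet Φ z = jacXx Φ z * jacYy Φ z - jacXy Φ z * jacYx Φ z := rfl
  refine ⟨hpz.smooth', ?_, ?_⟩
  -- The witness inverts the affine law of `φ` by Cramer's rule; any compatible pair for `E'` forces
  -- its `F5` to vanish.
  · refine IsCompatible.F5_eq_zero hsz ((PullbackAt.isCompatible_iff hz
      ((jacYy Φ z * (E.phi 0 z + 3 * jacLog Φ 0 z) - jacYx Φ z * (E.phi 1 z + 3 * jacLog Φ 1 z))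
        / jacDet Φ z)
      ((jacXx Φ z * (E.phi 1 z + 3 * jacLog Φ 1 z) - jacXy Φ z * (E.phi 0 z + 3 * jacLog Φ 0 z))
        / jacDet Φ z)).1 ?_)
    convert hEz.isCompatible_phi using 1
    · field_simp; rw [hDe]; ring
    · field_simp; rw [hDe]; ring
  · obtain ⟨l1, l2⟩ := PullbackAt.beta_law hz
    by_contra! hb
    have := hEz.self_of_nhds.2.2
    rw [l1, l2, hb.1, hb.2] at this
    simp at this

theorem PullbackAt.phi_law (h : ∀ᶠ z in 𝓝 p, E.PullbackAt E' Φ z) (hE : E.DegenerateAt p) :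
    E.phi 0 p = jacXx Φ p * E'.phi 0 (Φ p) + jacYx Φ p * E'.phi 1 (Φ p) - 3 * jacLog Φ 0 p ∧
    E.phi 1 p = jacXy Φ p * E'.phi 0 (Φ p) + jacYy Φ p * E'.phi 1 (Φ p) - 3 * jacLog Φ 1 p :=
  hE.isCompatible_phi.unique hE.self_of_nhds.2.2
    ((PullbackAt.isCompatible_iff h _ _).2 (PullbackAt.degenerateAt h hE).isCompatible_phi)

/-- In the derivative of `phi_law` the `jacLog` terms cancel against the defect of the alphas, so
the symmetric Ricci part pulls back as a quadratic form. -/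
theorem PullbackAt.det_ric (h : ∀ᶠ z in 𝓝 p, E.PullbackAt E' Φ z) (hE : E.DegenerateAt p)
    (hb : E'.beta1 (Φ p) ≠ 0) :
    E.ric11 p * E.ric22 p - E.ric12 p ^ 2 = jacDet Φ p ^ 2 *
      (E'.ric11 (Φ p) * E'.ric22 (Φ p) - E'.ric12 (Φ p) ^ 2) := by
  have hp := h.self_of_nhds
  have hs := hp.smoothMap
  have h1 := hs.jacXx
  have h2 := hs.jacXy
  have h3 := hs.jacYx
  have h4 := hs.jacYy
  have h5 := hs.jacLog hp.det_ne 0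
  have h6 := hs.jacLog hp.det_ne 1
  have hE' := PullbackAt.degenerateAt h hE
  have hf0 := hE'.contDiffAt_phi hb 0
  have hf1 := hE'.contDiffAt_phi hb 1
  have c0 := pd_zero_comp hf0 hs
  have c1 := pd_zero_comp hf1 hs
  have d0 := pd_one_comp hf0 hs
  have d1 := pd_one_comp hf1 hs
  have s0 : ContDiffAt ℝ ∞ (fun z => E'.phi 0 (Φ z)) p := hf0.comp p hs
  have s1 : ContDiffAt ℝ ∞ (fun z => E'.phi 1 (Φ z)) p := hf1.comp p hs
  obtain ⟨cX, cY⟩ := jac_xy_comm hs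
  obtain ⟨l00, l01, l10, l11⟩ := PullbackAt.jacLog_law h
  have hl := (h.eventually_nhds.and hE.eventually).mono fun _ hz => PullbackAt.phi_law hz.1 hz.2
  obtain ⟨l0, l1⟩ := hl.self_of_nhds
  have e1 := fun i => pd_congr (i := i) (hl.mono fun _ h => h.1)
  have e2 := fun i => pd_congr (i := i) (hl.mono fun _ h => h.2)
  have e10 := e1 0
  have e11 := e1 1
  have e20 := e2 0
  have e21 := e2 1
  simp (disch := fun_prop) only [pd_add, pd_sub, pd_mul, pd_const, c0, c1, d0, d1, cX, cY,
    l00, l01, l10, l11, hp.Xxx, hp.Xxy, hp.Xyy, hp.Yxx, hp.Yxy, hp.Yyy] at e10 e11 e20 e21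
  have k11 : E.ric11 p = jacXx Φ p ^ 2 * E'.ric11 (Φ p)
      + 2 * jacXx Φ p * jacYx Φ p * E'.ric12 (Φ p) + jacYx Φ p ^ 2 * E'.ric22 (Φ p) := by
    simp only [ric11, ric12, ric22, dx, dy, e10, l0, l1]
    ring
  have k12 : E.ric12 p = jacXx Φ p * jacXy Φ p * E'.ric11 (Φ p)
      + (jacXx Φ p * jacYy Φ p + jacXy Φ p * jacYx Φ p) * E'.ric12 (Φ p)
      + jacYx Φ p * jacYy Φ p * E'.ric22 (Φ p) := by
    simp only [ric11, ric12, ric22, dx, dy, e11, e20, l0, l1]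
    ring
  have k22 : E.ric22 p = jacXy Φ p ^ 2 * E'.ric11 (Φ p)
      + 2 * jacXy Φ p * jacYy Φ p * E'.ric12 (Φ p) + jacYy Φ p ^ 2 * E'.ric22 (Φ p) := by
    simp only [ric11, ric12, ric22, dx, dy, e21, l0, l1]
    ring
  rw [k11, k12, k22, jacDet]
  ring

end CubicODE

end PointTransformations

/-! ### The weight of `j5` and its curvature formula -/

theorem lemma5p6 (E : CubicODE) (U : Set (ℝ × ℝ)) (hU : IsOpen U) (hE : E.SmoothOn U)
    (hdeg : E.IntermediateDegeneration U) :
    (∀ (E' : CubicODE) (V : Set (ℝ × ℝ)) (Φ : ℝ × ℝ → ℝ × ℝ),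
      IsOpen V → E'.SmoothOn V → IsPointTransformation Φ U V → E.TransformsTo Φ U E' →
      ∀ p ∈ U, E.beta1 p ≠ 0 → E'.beta1 (Φ p) ≠ 0 →
        E.j5 p = (transitionMatrix Φ p).det ^ 2 * E'.j5 (Φ p)) ∧
    (∀ p ∈ U, E.beta1 p ≠ 0 →
      E.j5 p = -125 * (E.curv p).det + 45 / 4 * E.Omega p ^ 2) := by
  refine ⟨fun E' V Φ hV hE' hΦ ht p hp hb hb' => ?_, fun p hp hb => ?_⟩
  · have h : ∀ᶠ z in nhds p, E.PullbackAt E' Φ z := by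
      filter_upwards [hU.mem_nhds hp] with z hz
      exact ht.pullbackAt hU hE hV hE' hΦ hz
    have hd := hE.degenerateAt hU hdeg hp
    rw [hd.j5_eq hb, (CubicODE.PullbackAt.degenerateAt h hd).j5_eq hb', det_transitionMatrix,
      CubicODE.PullbackAt.det_ric h hd hb']
    ring
  · have hd := hE.degenerateAt hU hdeg hp
    rw [hd.j5_eq hb, hd.det_curv hb]
    ring
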